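/- Let $R$ and $S$ be associative rings with unit. All modules are unitary, and right modules are identified with left modules over the opposite ring. For a module $M$ put $M^+=\operatorname{Hom}_{\mathbb Z}(M,\mathbb Q/\mathbb Z)$, a right module if $M$ is a left module. A module is *super finitely presented* if it has a projective resolution consisting of finitely generated projective modules. A left $R$-module $I$ is *weak injective* if $\operatorname{Ext}^1_R(N,I)=0$ for every super finitely presented left $R$-module $N$. A left (resp. right) $R$-module $F$ is *weak flat* if $\operatorname{Tor}_1^R(N,F)=0$ for every super finitely presented right $R$-module $N$ (resp. $\operatorname{Tor}_1^R(F,N)=0$ for every super finitely presented left $R$-module $N$). The same definitions are used over $S$, $R^{op}$ and $S^{op}$. Let $C={}_SC_R$ be a faithfully semidualizing bimodule, that is, an $(S,R)$-bimodule such that: (a) ${}_SC$ and $C_R$ are super finitely presented; (b) the homothety maps $S\to\operatorname{Hom}_{R^{op}}(C,C)$ and $R\to\operatorname{Hom}_S(C,C)$ are bijective; (c) $\operatorname{Ext}^i_S(C,C)=0$ and $\operatorname{Ext}^i_{R^{op}}(C,C)=0$ for all $i\ge 1$; (d) for every left $S$-module $N$ and every right $R$-module $M$, $\operatorname{Hom}_S(C,N)=0$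 implies $N=0$, and $\operatorname{Hom}_{R^{op}}(C,M)=0$ implies $M=0$. Define the following classes of modules, each closed under isomorphism: - $\mathcal{WF}_C(S)$: the left $S$-modules of the form $C\otimes_R F$ with $F$ a weak flat left $R$-module; - $\mathcal{WI}_C(R)$: the left $R$-modules of the form $\operatorname{Hom}_S(C,I)$ with $I$ a weak injective left $S$-module; - $\mathcal{WI}_C(S^{op})$: the right $S$-modules of the form $\operatorname{Hom}_{R^{op}}(C,I)$ with $I$ a weak injective right $R$-module; - $\mathcal{WF}_C(R^{op})$: the right $R$-modules of the form $F\otimes_S C$ with $F$ a weak flat right $S$-module. **Proposition.** Let $V$ be a left $S$-module and $U$ a left $R$-module. 1. $V\in\mathcal{WF}_C(S)$ if and only if $V^+\in\mathcal{WI}_C(S^{op})$. 2. $U\in\mathcal{WI}_C(R)$ if and only if $U^+\in\mathcal{WF}_C(R^{op})$. -/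

import Mathlib

open CategoryTheory MulOpposite TensorProduct

universe u

/-! Right `R`-modules are left modules over `Rᵐᵒᵖ`: the product `m r` is `op r • m`.
An `(S, R)`-bimodule `C` has `[Module S C] [Module Rᵐᵒᵖ C] [SMulCommClass S Rᵐᵒᵖ C]`. -/

noncomputable section

namespace CWeak

/-! ### Tensor product over a noncommutative ring -/

section Tensor

variable (R : Type u) [Ring R]
variable (M : Type u) [AddCommGroup M] [Module Rᵐᵒᵖ M]
variable (N : Type u) [AddCommGroup N] [Module R N]

/-- The subgroup of `M ⊗_ℤ N` generated by the elements `(m r) ⊗ n - m ⊗ (r n)`. -/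
def balancing : AddSubgroup (M ⊗[ℤ] N) :=
  AddSubgroup.closure
    {x | ∃ (m : M) (r : R) (n : N), x = (op r • m) ⊗ₜ[ℤ] n - m ⊗ₜ[ℤ] (r • n)}

/-- The abelian group `M ⊗_R N` for a right `R`-module `M` and a left `R`-module `N`. -/
abbrev Tens : Type u := (M ⊗[ℤ] N) ⧸ balancing R M N

variable {M N}

/-- The elementary tensor `m ⊗ n` of `M ⊗_R N`. -/
def tmul (m : M) (n : N) : Tens R M N := QuotientAddGroup.mk' (balancing R M N) (m ⊗ₜ[ℤ] n)

theorem smul_tmul (r : R) (m : M) (n : N) :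
    tmul R (op r • m) n = tmul R m (r • n) := by
  rw [← sub_eq_zero, tmul, tmul, ← map_sub, QuotientAddGroup.mk'_apply,
    QuotientAddGroup.eq_zero_iff]
  exact AddSubgroup.subset_closure ⟨m, r, n, rfl⟩

theorem tmul_add (m : M) (n n' : N) : tmul R m (n + n') = tmul R m n + tmul R m n' := by
  rw [tmul, TensorProduct.tmul_add, map_add]; rfl

theorem add_tmul (m m' : M) (n : N) : tmul R (m + m') n = tmul R m n + tmul R m' n := by
  rw [tmul, TensorProduct.add_tmul, map_add]; rfl

theorem tmul_zero (m : M) : tmul R m (0 : N) = 0 := by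
  rw [tmul, TensorProduct.tmul_zero, map_zero]

theorem zero_tmul (n : N) : tmul R (0 : M) n = 0 := by
  rw [tmul, TensorProduct.zero_tmul, map_zero]

theorem tens_hom_ext {P : Type*} [AddCommGroup P] {f g : Tens R M N →+ P}
    (h : ∀ m n, f (tmul R m n) = g (tmul R m n)) : f = g := by
  refine DFunLike.ext _ _ fun z => ?_
  obtain ⟨y, rfl⟩ := QuotientAddGroup.mk'_surjective _ z
  induction y with
  | zero => rw [map_zero, map_zero, map_zero]
  | tmul m n => exact h m n
  | add x y hx hy => rw [map_add, map_add, map_add, hx, hy]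

variable {M' : Type u} [AddCommGroup M'] [Module Rᵐᵒᵖ M']
variable {N' : Type u} [AddCommGroup N'] [Module R N']

/-- The homomorphism `f ⊗ g : M ⊗_R N → M' ⊗_R N'`. -/
def tmap (f : M →ₗ[Rᵐᵒᵖ] M') (g : N →ₗ[R] N') : Tens R M N →+ Tens R M' N' :=
  QuotientAddGroup.map _ _
    (TensorProduct.map f.toAddMonoidHom.toIntLinearMap
      g.toAddMonoidHom.toIntLinearMap).toAddMonoidHom <| by
    rw [balancing, AddSubgroup.closure_le]
    rintro _ ⟨m, r, n, rfl⟩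
    refine AddSubgroup.subset_closure ⟨f m, r, g n, ?_⟩
    rw [map_sub]
    change f (op r • m) ⊗ₜ[ℤ] g n - f m ⊗ₜ[ℤ] g (r • n) = _
    rw [map_smul, map_smul]

@[simp] theorem tmap_tmul (f : M →ₗ[Rᵐᵒᵖ] M') (g : N →ₗ[R] N') (m : M) (n : N) :
    tmap R f g (tmul R m n) = tmul R (f m) (g n) := rfl

/-- For an `(A, R)`-bimodule `M`, the left `A`-module structure on `M ⊗_R N`, with
`a (m ⊗ n) = (a m) ⊗ n`. -/
@[reducible] def leftAction (A : Type u) [Ring A] (M N : Type u) [AddCommGroup M]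
    [Module Rᵐᵒᵖ M] [AddCommGroup N] [Module R N] [Module A M] [SMulCommClass A Rᵐᵒᵖ M] :
    Module A (Tens R M N) where
  smul a z := tmap R (Module.toModuleEnd Rᵐᵒᵖ (S := A) M a) LinearMap.id z
  smul_add a x y := map_add (tmap R _ _) x y
  smul_zero a := map_zero (tmap R _ _)
  zero_smul z := by
    change tmap R _ _ z = (0 : Tens R M N →+ Tens R M N) z
    refine DFunLike.congr_fun (tens_hom_ext R fun m n => ?_) z
    simp [zero_tmul]
  add_smul a b z := by
    change tmap R _ _ z = (tmap R _ _ + tmap R _ _ : Tens R M N →+ Tens R M N) z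
    refine DFunLike.congr_fun (tens_hom_ext R fun m n => ?_) z
    simp [add_smul, add_tmul]
  mul_smul a b z := by
    change tmap R _ _ z = ((tmap R _ _).comp (tmap R _ _) : Tens R M N →+ Tens R M N) z
    refine DFunLike.congr_fun (tens_hom_ext R fun m n => ?_) z
    simp [mul_smul]
  one_smul z := by
    change tmap R _ _ z = AddMonoidHom.id _ z
    refine DFunLike.congr_fun (tens_hom_ext R fun m n => ?_) z
    simp

/-- If `N` has an action of `A` that commutes with the left action of `R`, the induced
`A`-module structure on `M ⊗_R N`, with `a (m ⊗ n) = m ⊗ (a n)`.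
(For an `(R, B)`-bimodule `N` take `A = Bᵐᵒᵖ`: this is the right `B`-module `M ⊗_R N`.) -/
@[reducible] def rightAction (A : Type u) [Ring A] (M N : Type u) [AddCommGroup M]
    [Module Rᵐᵒᵖ M] [AddCommGroup N] [Module R N] [Module A N] [SMulCommClass A R N] :
    Module A (Tens R M N) where
  smul a z := tmap R LinearMap.id (Module.toModuleEnd R (S := A) N a) z
  smul_add a x y := map_add (tmap R _ _) x y
  smul_zero a := map_zero (tmap R _ _)
  zero_smul z := by
    change tmap R _ _ z = (0 : Tens R M N →+ Tens R M N) z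
    refine DFunLike.congr_fun (tens_hom_ext R fun m n => ?_) z
    simp [tmul_zero]
  add_smul a b z := by
    change tmap R _ _ z = (tmap R _ _ + tmap R _ _ : Tens R M N →+ Tens R M N) z
    refine DFunLike.congr_fun (tens_hom_ext R fun m n => ?_) z
    simp [add_smul, tmul_add]
  mul_smul a b z := by
    change tmap R _ _ z = ((tmap R _ _).comp (tmap R _ _) : Tens R M N →+ Tens R M N) z
    refine DFunLike.congr_fun (tens_hom_ext R fun m n => ?_) z
    simp [mul_smul]
  one_smul z := by
    change tmap R _ _ z = AddMonoidHom.id _ z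
    refine DFunLike.congr_fun (tens_hom_ext R fun m n => ?_) z
    simp

end Tensor

/-! ### Tor -/

section Tor

variable (R : Type u) [Ring R]

/-- The functor `M ⊗_R -` from left `R`-modules to abelian groups. -/
def tensLeft (M : Type u) [AddCommGroup M] [Module Rᵐᵒᵖ M] :
    ModuleCat.{u} R ⥤ AddCommGrpCat.{u} where
  obj N := AddCommGrpCat.of (Tens R M N)
  map g := AddCommGrpCat.ofHom (tmap R (LinearMap.id : M →ₗ[Rᵐᵒᵖ] M) g.hom)
  map_id N := by
    refine AddCommGrpCat.hom_ext (show (tmap R LinearMap.id LinearMap.id : _ →+ _) =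
      AddMonoidHom.id _ from
      tens_hom_ext R fun m n => ?_)
    simp
  map_comp f g := by
    refine AddCommGrpCat.hom_ext (show (tmap R LinearMap.id (g.hom.comp f.hom) : _ →+ _) =
      (tmap R LinearMap.id g.hom).comp (tmap R LinearMap.id f.hom) from
      tens_hom_ext R fun m n => ?_)
    simp

instance (M : Type u) [AddCommGroup M] [Module Rᵐᵒᵖ M] : (tensLeft R M).Additive where
  map_add {X Y f g} := by
    refine AddCommGrpCat.hom_ext (show (tmap R LinearMap.id (f.hom + g.hom) : _ →+ _) =
      tmap R LinearMap.id f.hom + tmap R LinearMap.id g.hom from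
      tens_hom_ext R fun m n => ?_)
    simp [tmul_add]

/-- The functor `- ⊗_R N` from right `R`-modules to abelian groups. -/
def tensRight (N : Type u) [AddCommGroup N] [Module R N] :
    ModuleCat.{u} Rᵐᵒᵖ ⥤ AddCommGrpCat.{u} where
  obj M := AddCommGrpCat.of (Tens R M N)
  map f := AddCommGrpCat.ofHom (tmap R f.hom (LinearMap.id : N →ₗ[R] N))
  map_id M := by
    refine AddCommGrpCat.hom_ext (show (tmap R LinearMap.id LinearMap.id : _ →+ _) =
      AddMonoidHom.id _ from
      tens_hom_ext R fun m n => ?_)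
    simp
  map_comp f g := by
    refine AddCommGrpCat.hom_ext (show (tmap R (g.hom.comp f.hom) LinearMap.id : _ →+ _) =
      (tmap R g.hom LinearMap.id).comp (tmap R f.hom LinearMap.id) from
      tens_hom_ext R fun m n => ?_)
    simp

instance (N : Type u) [AddCommGroup N] [Module R N] : (tensRight R N).Additive where
  map_add {X Y f g} := by
    refine AddCommGrpCat.hom_ext (show (tmap R (f.hom + g.hom) LinearMap.id : _ →+ _) =
      tmap R f.hom LinearMap.id + tmap R g.hom LinearMap.id from
      tens_hom_ext R fun m n => ?_)
    simp [add_tmul]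

/-- `Tor_n^R(M, N)`, computed from a projective resolution of the left module `N`. -/
def TorL (M : Type u) [AddCommGroup M] [Module Rᵐᵒᵖ M] (n : ℕ) (N : ModuleCat.{u} R) :
    AddCommGrpCat.{u} :=
  ((tensLeft R M).leftDerived n).obj N

/-- `Tor_n^R(M, N)`, computed from a projective resolution of the right module `M`.
(By balance of `Tor` this is the same group as the one above.) -/
def TorR (N : Type u) [AddCommGroup N] [Module R N] (n : ℕ) (M : ModuleCat.{u} Rᵐᵒᵖ) :
    AddCommGrpCat.{u} :=
  ((tensRight R N).leftDerived n).obj M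

end Tor

/-! ### Super finitely presented, weak injective and weak flat modules -/

/-- `M` is super finitely presented: it has a projective resolution by finitely generated
projective modules. -/
def SuperFP (A : Type u) [Ring A] (M : ModuleCat.{u} A) : Prop :=
  ∃ P : ProjectiveResolution M, ∀ n, Module.Finite A (P.complex.X n)

/-- The left `A`-module `I` is weak injective: `Ext¹_A(F, I) = 0` for all super finitely
presented left `A`-modules `F`. -/
def WeakInjective (A : Type u) [Ring A] (I : Type u) [AddCommGroup I] [Module A I] : Prop :=
  ∀ F : ModuleCat.{u} A, SuperFP A F → Subsingleton (Abelian.Ext F (ModuleCat.of A I) 1)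

/-- The left `R`-module `F` is weak flat: `Tor_1^R(N, F) = 0` for all super finitely
presented right `R`-modules `N`. -/
def WeakFlat (R : Type u) [Ring R] (F : Type u) [AddCommGroup F] [Module R F] : Prop :=
  ∀ N : ModuleCat.{u} Rᵐᵒᵖ, SuperFP Rᵐᵒᵖ N → Subsingleton (TorR R F 1 N)

/-- The right `R`-module `F` is weak flat: `Tor_1^R(F, N) = 0` for all super finitely
presented left `R`-modules `N`. -/
def WeakFlatRight (R : Type u) [Ring R] (F : Type u) [AddCommGroup F] [Module Rᵐᵒᵖ F] : Prop :=
  ∀ N : ModuleCat.{u} R, SuperFP R N → Subsingleton (TorL R F 1 N)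

/-! ### The character module -/

/-- For a left `A`-module `M`, the right `A`-module `M⁺ = Hom_ℤ(M, ℚ/ℤ)`, with
`(f a)(m) = f(a m)`. -/
def charModule (A : Type u) [Ring A] (M : Type u) [AddCommGroup M] [Module A M] :
    ModuleCat.{u} Aᵐᵒᵖ :=
  letI : Module Aᵐᵒᵖ (M →+ AddCircle (1 : ℚ)) :=
    { smul := fun a f => f.comp (DistribSMul.toAddMonoidHom M a.unop)
      smul_add := fun a f g => by ext m; rfl
      smul_zero := fun a => by ext m; rfl
      zero_smul := fun f => by
        ext m
        change f ((0 : A) • m) = 0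
        rw [zero_smul, map_zero]
      add_smul := fun a b f => by
        ext m
        change f ((a.unop + b.unop) • m) = f (a.unop • m) + f (b.unop • m)
        rw [add_smul, map_add]
      mul_smul := fun a b f => by
        ext m
        change f ((b.unop * a.unop) • m) = f (b.unop • a.unop • m)
        rw [mul_smul]
      one_smul := fun f => by
        ext m
        change f ((1 : A) • m) = f m
        rw [one_smul] }
  ModuleCat.of Aᵐᵒᵖ (M →+ AddCircle (1 : ℚ))

/-! ### Bimodules -/

section Bimodule

variable (S R C : Type u) [Ring S] [Ring R] [AddCommGroup C] [Module S C] [Module Rᵐᵒᵖ C]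
variable [SMulCommClass S Rᵐᵒᵖ C]

/-- Multiplication by `r` on the right, `c ↦ c r`, as an `S`-endomorphism of `C`. -/
def rightMul (r : R) : C →ₗ[S] C where
  toFun c := op r • c
  map_add' := smul_add _
  map_smul' s c := (smul_comm s (op r) c).symm

/-- Multiplication by `s` on the left, `c ↦ s c`, as an `Rᵐᵒᵖ`-endomorphism of `C`. -/
def leftMul (s : S) : C →ₗ[Rᵐᵒᵖ] C where
  toFun c := s • c
  map_add' := smul_add _
  map_smul' r c := smul_comm s r c

/-- `C` is a semidualizing `(S, R)`-bimodule. -/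
structure Semidualizing : Prop where
  superFP_left : SuperFP S (ModuleCat.of S C)
  superFP_right : SuperFP Rᵐᵒᵖ (ModuleCat.of Rᵐᵒᵖ C)
  homothety_left : Function.Bijective (leftMul S R C)
  homothety_right : Function.Bijective (rightMul S R C)
  ext_left : ∀ i : ℕ, 1 ≤ i →
    Subsingleton (Abelian.Ext (ModuleCat.of S C) (ModuleCat.of S C) i)
  ext_right : ∀ i : ℕ, 1 ≤ i →
    Subsingleton (Abelian.Ext (ModuleCat.of Rᵐᵒᵖ C) (ModuleCat.of Rᵐᵒᵖ C) i)

/-- `C` is a faithfully semidualizing `(S, R)`-bimodule. -/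
structure FaithfullySemidualizing : Prop extends Semidualizing S R C where
  faithful_left : ∀ N : ModuleCat.{u} S, Subsingleton (C →ₗ[S] N) → Subsingleton N
  faithful_right : ∀ M : ModuleCat.{u} Rᵐᵒᵖ, Subsingleton (C →ₗ[Rᵐᵒᵖ] M) → Subsingleton M

/-- The left `S`-module `C ⊗_R F` of a left `R`-module `F`. -/
def tensObj (F : Type u) [AddCommGroup F] [Module R F] : ModuleCat.{u} S :=
  letI : Module S (Tens R C F) := leftAction R S C F
  ModuleCat.of S (Tens R C F)

/-- The right `R`-module `F ⊗_S C` of a right `S`-module `F`. -/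
def tensObjRight (F : Type u) [AddCommGroup F] [Module Sᵐᵒᵖ F] : ModuleCat.{u} Rᵐᵒᵖ :=
  haveI : SMulCommClass Rᵐᵒᵖ S C := SMulCommClass.symm S Rᵐᵒᵖ C
  letI : Module Rᵐᵒᵖ (Tens S F C) := rightAction S Rᵐᵒᵖ F C
  ModuleCat.of Rᵐᵒᵖ (Tens S F C)

/-- The left `R`-module `Hom_S(C, I)` of a left `S`-module `I`, with `(r f)(c) = f(c r)`. -/
def homObj (I : Type u) [AddCommGroup I] [Module S I] : ModuleCat.{u} R :=
  letI : Module R (C →ₗ[S] I) :=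
    { smul := fun r f => f.comp (rightMul S R C r)
      smul_add := fun r f g => rfl
      smul_zero := fun r => rfl
      zero_smul := fun f => by
        ext c
        change f ((0 : Rᵐᵒᵖ) • c) = 0
        rw [zero_smul, map_zero]
      add_smul := fun r r' f => by
        ext c
        change f ((op r + op r') • c) = f (op r • c) + f (op r' • c)
        rw [add_smul, map_add]
      mul_smul := fun r r' f => by
        ext c
        change f ((op r' * op r) • c) = f (op r' • op r • c)
        rw [mul_smul]
      one_smul := fun f => by
        ext c
        change f ((1 : Rᵐᵒᵖ) • c) = f c
        rw [one_smul] }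
  ModuleCat.of R (C →ₗ[S] I)

/-- The right `S`-module `Hom_{Rᵒᵖ}(C, I)` of a right `R`-module `I`, with
`(f s)(c) = f(s c)`. -/
def homObjRight (I : Type u) [AddCommGroup I] [Module Rᵐᵒᵖ I] : ModuleCat.{u} Sᵐᵒᵖ :=
  letI : Module Sᵐᵒᵖ (C →ₗ[Rᵐᵒᵖ] I) :=
    { smul := fun s f => f.comp (leftMul S R C s.unop)
      smul_add := fun s f g => rfl
      smul_zero := fun s => rfl
      zero_smul := fun f => by
        ext c
        change f ((0 : S) • c) = 0
        rw [zero_smul, map_zero]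
      add_smul := fun s s' f => by
        ext c
        change f ((s.unop + s'.unop) • c) = f (s.unop • c) + f (s'.unop • c)
        rw [add_smul, map_add]
      mul_smul := fun s s' f => by
        ext c
        change f ((s'.unop * s.unop) • c) = f (s'.unop • s.unop • c)
        rw [mul_smul]
      one_smul := fun f => by
        ext c
        change f ((1 : S) • c) = f c
        rw [one_smul] }
  ModuleCat.of Sᵐᵒᵖ (C →ₗ[Rᵐᵒᵖ] I)

/-- The left `S`-module `V` is `C`-weak flat: `V ≅ C ⊗_R F` for a weak flat left
`R`-module `F`. -/
def CWeakFlat (V : ModuleCat.{u} S) : Prop :=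
  ∃ F : ModuleCat.{u} R, WeakFlat R F ∧ Nonempty (V ≅ tensObj S R C F)

/-- The left `R`-module `U` is `C`-weak injective: `U ≅ Hom_S(C, I)` for a weak injective left
`S`-module `I`. -/
def CWeakInjective (U : ModuleCat.{u} R) : Prop :=
  ∃ I : ModuleCat.{u} S, WeakInjective S I ∧ Nonempty (U ≅ homObj S R C I)

/-- The right `R`-module `U` is `C`-weak flat: `U ≅ F ⊗_S C` for a weak flat right
`S`-module `F`. -/
def CWeakFlatRight (U : ModuleCat.{u} Rᵐᵒᵖ) : Prop :=
  ∃ F : ModuleCat.{u} Sᵐᵒᵖ, WeakFlatRight S F ∧ Nonempty (U ≅ tensObjRight S R C F)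

/-- The right `S`-module `V` is `C`-weak injective: `V ≅ Hom_{Rᵒᵖ}(C, I)` for a weak injective
right `R`-module `I`. -/
def CWeakInjectiveRight (V : ModuleCat.{u} Sᵐᵒᵖ) : Prop :=
  ∃ I : ModuleCat.{u} Rᵐᵒᵖ, WeakInjective Rᵐᵒᵖ I ∧ Nonempty (V ≅ homObjRight S R C I)

end Bimodule

end CWeak

end

noncomputable section

namespace CWeak

/-! ### Ext and Tor in degree one, read off a projective resolution -/

section Derived

variable {A : Type u} [Ring A] {N : ModuleCat.{u} A}

/-! Since ℚ/ℤ is an injective cogenerator, characters detect exactness and bijectivity. Dualizing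
the complexes that compute Tor₁ and Ext¹ shows that `F` is weak flat iff `F⁺` is weak injective
(adjunction) and that `I` is weak injective iff `I⁺` is weak flat (for finitely presented `P`, `I⁺ ⊗
P ≅ Hom(P, I)⁺`: `charTens_bijective`). The forward implications then follow from `(C ⊗ F)⁺ ≅ Hom(C,
F⁺)` and `Hom(C, I)⁺ ≅ I⁺ ⊗ C`.

The converses need the evaluation `Hom(C, I) ⊗ C → I` to be bijective for weak injective `I`, and
the unit `F → Hom(C, F ⊗ C)` for weak flat `F`. Both rest on `WeakInjective.presentation_exact`. If
`A = End_B(C)` and `Bᵐ → Bⁿ → C → 0` is a presentation, then `Hom_B(-, C)` gives an exact sequence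
`0 → A → Cⁿ → Cᵐ`. Cokernels of injections between super finitely presented modules are super
finitely presented, so `Hom_A(-, I)` keeps this exact: `Hom_A(C, I)ᵐ → Hom_A(C, I)ⁿ → I → 0`. This
identifies `I` with `Hom_A(C, I) ⊗_B C`. The unit is handled by applying the same to `F⁺` and
dualizing.

If now `V⁺ ≅ Hom(C, I)`, then `I ≅ V⁺ ⊗ C ≅ Hom(C, V)⁺`. Hence `Hom(C, V)` is weak flat, and the
dual of the evaluation `C ⊗ Hom(C, V) → V` is an isomorphism, so the evaluation is one too. If `U⁺ ≅
F ⊗ C`, then `F ≅ Hom(C, U⁺) ≅ (C ⊗ U)⁺`. Hence `C ⊗ U` is weak injective, and `U → Hom(C, C ⊗ U)`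
is bijective because its dual is. -/

theorem ext_one_subsingleton_iff (P : ProjectiveResolution N) (I : ModuleCat.{u} A) :
    Subsingleton (Abelian.Ext N I 1) ↔
      ∀ f : P.complex.X 1 →ₗ[A] I, f ∘ₗ (P.complex.d 2 1).hom = 0 →
        ∃ g : P.complex.X 0 →ₗ[A] I, g ∘ₗ (P.complex.d 1 0).hom = f := by
  constructor
  · intro h f hf
    have hf' : P.complex.d 2 1 ≫ ModuleCat.ofHom f = 0 := ModuleCat.hom_ext hf
    obtain ⟨g, hg⟩ := (P.extMk_eq_zero_iff (ModuleCat.ofHom f) 2 rfl hf' 0 rfl).1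
      (Subsingleton.elim _ _)
    exact ⟨g.hom, congrArg ModuleCat.Hom.hom hg⟩
  · intro h
    refine subsingleton_of_forall_eq 0 fun α => ?_
    obtain ⟨f, hf, rfl⟩ := P.extMk_surjective α 2 rfl
    obtain ⟨g, hg⟩ := h f.hom (congrArg ModuleCat.Hom.hom hf)
    exact (P.extMk_eq_zero_iff f 2 rfl hf 0 rfl).2 ⟨ModuleCat.ofHom g, ModuleCat.hom_ext hg⟩

theorem leftDerived_one_subsingleton_iff (F : ModuleCat.{u} A ⥤ AddCommGrpCat.{u}) [F.Additive]
    (P : ProjectiveResolution N) :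
    Subsingleton ((F.leftDerived 1).obj N) ↔
      Function.Exact (F.map (P.complex.d 2 1)) (F.map (P.complex.d 1 0)) := by
  rw [← AddCommGrpCat.isZero_iff_subsingleton,
    (P.isoLeftDerivedObj F 1).isZero_iff]
  change Limits.IsZero (((F.mapHomologicalComplex _).obj P.complex).homology 1) ↔ _
  rw [← HomologicalComplex.exactAt_iff_isZero_homology,
    HomologicalComplex.exactAt_iff' _ 2 1 0 (by simp) (by simp),
    ShortComplex.ab_exact_iff_function_exact]
  rfl

theorem torL_one_subsingleton_iff (M : Type u) [AddCommGroup M] [Module Aᵐᵒᵖ M]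
    (P : ProjectiveResolution N) :
    Subsingleton (TorL A M 1 N) ↔
      Function.Exact (tmap A (LinearMap.id : M →ₗ[Aᵐᵒᵖ] M) (P.complex.d 2 1).hom)
        (tmap A (LinearMap.id : M →ₗ[Aᵐᵒᵖ] M) (P.complex.d 1 0).hom) :=
  leftDerived_one_subsingleton_iff (tensLeft A M) P

theorem torR_one_subsingleton_iff (R : Type u) [Ring R] (F : Type u) [AddCommGroup F] [Module R F]
    {N : ModuleCat.{u} Rᵐᵒᵖ} (P : ProjectiveResolution N) :
    Subsingleton (TorR R F 1 N) ↔
      Function.Exact (tmap R (P.complex.d 2 1).hom (LinearMap.id : F →ₗ[R] F))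
        (tmap R (P.complex.d 1 0).hom (LinearMap.id : F →ₗ[R] F)) :=
  leftDerived_one_subsingleton_iff (tensRight R F) P

open Abelian in
/-- A map into a weak injective module extends along any injection with super finitely presented
cokernel. -/
theorem WeakInjective.exists_extension {I X Y : Type u} [AddCommGroup I] [Module A I]
    [AddCommGroup X] [Module A X] [AddCommGroup Y] [Module A Y]
    (hI : WeakInjective A I) (i : X →ₗ[A] Y) (p : Y →ₗ[A] N) (hi : Function.Injective i)
    (hip : Function.Exact i p) (hp : Function.Surjective p) (hN : SuperFP A N) (f : X →ₗ[A] I) :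
    ∃ g : Y →ₗ[A] I, g ∘ₗ i = f := by
  have w : ModuleCat.ofHom i ≫ ModuleCat.ofHom p = 0 := by
    ext x; exact hip.apply_apply_eq_zero x
  let T : ShortComplex (ModuleCat.{u} A) := ShortComplex.mk (ModuleCat.ofHom i) (ModuleCat.ofHom p) w
  have hT : T.ShortExact :=
    { exact := (ShortComplex.ShortExact.moduleCat_exact_iff_function_exact T).2 hip
      mono_f := (ModuleCat.mono_iff_injective _).2 hi
      epi_g := (ModuleCat.epi_iff_surjective _).2 hp }
  have := hI N hN
  -- The obstruction to extending `f` is its image under the connecting map, an element of `Ext¹(N,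
  -- I) = 0`.
  obtain ⟨g, hg⟩ := Ext.contravariant_sequence_exact₁ hT (ModuleCat.of A I)
    (Ext.mk₀ (ModuleCat.ofHom f)) (n₁ := 1) rfl (Subsingleton.elim _ _)
  obtain ⟨g, rfl⟩ := Ext.homEquiv₀.symm.surjective g
  refine ⟨g.hom, ?_⟩
  rw [Ext.homEquiv₀_symm_apply, Ext.mk₀_comp_mk₀] at hg
  exact congrArg ModuleCat.Hom.hom ((Ext.mk₀_bijective _ _).1 hg)

end Derived

/-! ### Super finitely presented modules by coinduction -/

section SuperFP

variable {A : Type u} [Ring A]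

/-- `M` is covered by a finitely generated projective module with kernel in the class `T`. -/
def FiniteCover (T : ModuleCat.{u} A → Prop) (M : ModuleCat.{u} A) : Prop :=
  ∃ (P K : ModuleCat.{u} A) (i : K →ₗ[A] P) (p : P →ₗ[A] M), Module.Finite A P ∧
    Module.Projective A P ∧ Function.Injective i ∧ Function.Exact i p ∧ Function.Surjective p ∧ T K

theorem projective_of_module {P : ModuleCat.{u} A} (h : Module.Projective A P) : Projective P :=
  (IsProjective.iff_projective P).1 h

theorem module_projective {P : ModuleCat.{u} A} (h : Projective P) : Module.Projective A P :=
  (IsProjective.iff_projective P).2 h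

/-- Splicing short exact sequences into a projective resolution. -/
theorem superFP_of_sequences (K P : ℕ → ModuleCat.{u} A) (i : ∀ n, K (n + 1) →ₗ[A] P n)
    (p : ∀ n, P n →ₗ[A] K n) (hfin : ∀ n, Module.Finite A (P n))
    (hproj : ∀ n, Module.Projective A (P n)) (hi : ∀ n, Function.Injective (i n))
    (hip : ∀ n, Function.Exact (i n) (p n)) (hp : ∀ n, Function.Surjective (p n)) :
    SuperFP A (K 0) := by
  let d : ∀ n, P (n + 1) ⟶ P n := fun n => ModuleCat.ofHom (i n ∘ₗ p (n + 1))
  have hd : ∀ n, d (n + 1) ≫ d n = 0 := fun n => by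
    ext x
    change i n (p (n + 1) (i (n + 1) (p (n + 2) x))) = 0
    rw [(hip (n + 1)).apply_apply_eq_zero, map_zero]
  have hex : ∀ n, Function.Exact (d (n + 1)) (d n) := fun n x => by
    constructor
    · intro hx
      have hx' : p (n + 1) x = 0 := hi n (by rw [map_zero]; exact hx)
      obtain ⟨y, rfl⟩ := (hip (n + 1) x).1 hx'
      obtain ⟨z, rfl⟩ := hp (n + 2) y
      exact ⟨z, rfl⟩
    · rintro ⟨y, rfl⟩
      exact ConcreteCategory.congr_hom (hd n) y
  have h0 : d 0 ≫ ModuleCat.ofHom (p 0) = 0 := by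
    ext x; exact (hip 0).apply_apply_eq_zero _
  have hex0 : Function.Exact (d 0) (p 0) := fun x => by
    rw [hip 0 x]
    constructor
    · rintro ⟨y, rfl⟩
      obtain ⟨z, rfl⟩ := hp 1 y
      exact ⟨z, rfl⟩
    · rintro ⟨y, rfl⟩; exact ⟨_, rfl⟩
  let Q := ChainComplex.of P d hd
  have hQ : ∀ n, Q.d (n + 1) n = d n := fun n => ChainComplex.of_d P d n
  refine ⟨{ complex := Q
            projective := fun n => projective_of_module (hproj n)
            π := (ChainComplex.toSingle₀Equiv _ _).symm ⟨ModuleCat.ofHom (p 0), ?_⟩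
            quasiIso := ⟨fun n => ?_⟩ }, hfin⟩
  · exact (congrArg (· ≫ ModuleCat.ofHom (p 0)) (hQ 0)).trans h0
  · cases n with
    | zero =>
      -- In degree 0 a quasi-isomorphism onto `K 0` means exactness of `P 1 → P 0 → K 0 → 0`; in
      -- positive degrees it is exactness of the spliced complex.
      rw [ChainComplex.quasiIsoAt₀_iff, ShortComplex.quasiIso_iff_of_zeros']
      · refine (ShortComplex.exact_and_epi_g_iff_of_iso
          (S₂ := ShortComplex.mk (d 0) (ModuleCat.ofHom (p 0)) h0) ?_).2
          ⟨(ShortComplex.ShortExact.moduleCat_exact_iff_function_exact _).2 hex0,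
            (ModuleCat.epi_iff_surjective _).2 (hp 0)⟩
        exact ShortComplex.isoMk (Iso.refl _) (Iso.refl _) (Iso.refl _)
          ((Category.id_comp _).trans ((hQ 0).symm.trans (Category.comp_id _).symm))
          ((Category.id_comp _).trans (Category.comp_id _).symm)
      all_goals rfl
    | succ n =>
      rw [quasiIsoAt_iff_exactAt']
      · rw [HomologicalComplex.exactAt_iff' _ (n + 1 + 1) (n + 1) n (by simp) (by simp)]
        refine (ShortComplex.exact_iff_of_iso
          (S₂ := ShortComplex.mk (d (n + 1)) (d n) (hd n)) ?_).2
          ((ShortComplex.ShortExact.moduleCat_exact_iff_function_exact _).2 (hex n))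
        exact ShortComplex.isoMk (Iso.refl _) (Iso.refl _) (Iso.refl _)
          ((Category.id_comp _).trans ((hQ _).symm.trans (Category.comp_id _).symm))
          ((Category.id_comp _).trans ((hQ _).symm.trans (Category.comp_id _).symm))
      · apply ChainComplex.exactAt_succ_single_obj

/-- Coinduction principle for super finitely presented modules. -/
theorem superFP_of_class (T : ModuleCat.{u} A → Prop) (h : ∀ M, T M → FiniteCover T M)
    {M : ModuleCat.{u} A} (hM : T M) : SuperFP A M := by
  choose! P K i p hfin hproj hi hip hp hK using h
  -- Iterated syzygies; membership in `T` is carried along so that each kernel can be covered again.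
  let s : ℕ → {M // T M} := fun n => Nat.rec ⟨M, hM⟩ (fun _ x => ⟨K x.1, hK x.1 x.2⟩) n
  exact superFP_of_sequences (fun n => (s n).1) (fun n => P (s n).1) (fun n => i (s n).1)
    (fun n => p (s n).1) (fun n => hfin _ (s n).2) (fun n => hproj _ (s n).2)
    (fun n => hi _ (s n).2) (fun n => hip _ (s n).2) (fun n => hp _ (s n).2)

theorem resolution_exact {M : ModuleCat.{u} A} (P : ProjectiveResolution M) (n : ℕ) :
    Function.Exact (P.complex.d (n + 2) (n + 1)) (P.complex.d (n + 1) n) :=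
  (ShortComplex.ShortExact.moduleCat_exact_iff_function_exact _).1 (P.exact_succ n)

/-- The first syzygy is resolved by the truncated resolution. Instead of shifting the complex,
coinduction is applied to the class of modules isomorphic to the image of some differential. -/
theorem SuperFP.finiteCover {M : ModuleCat.{u} A} (hM : SuperFP A M) :
    FiniteCover (SuperFP A) M := by
  obtain ⟨P, hP⟩ := hM
  let T : ModuleCat.{u} A → Prop := fun X => ∃ (n : ℕ) (i : X →ₗ[A] P.complex.X n),
    Function.Injective i ∧ LinearMap.range i = LinearMap.range (P.complex.d (n + 1) n).hom
  have key : ∀ X, T X → SuperFP A X := fun X => superFP_of_class T <| by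
    rintro X ⟨n, i, hi, hr⟩
    let e := LinearEquiv.ofInjective i hi
    have hmem (x) : (P.complex.d (n + 1) n).hom x ∈ LinearMap.range i := hr ▸ ⟨x, rfl⟩
    let p : P.complex.X (n + 1) →ₗ[A] X :=
      e.symm.toLinearMap ∘ₗ (P.complex.d (n + 1) n).hom.codRestrict _ hmem
    have hpi : ∀ x, i (p x) = (P.complex.d (n + 1) n).hom x := fun x =>
      congrArg Subtype.val (e.apply_symm_apply _)
    refine ⟨P.complex.X (n + 1), ModuleCat.of A (LinearMap.range (P.complex.d (n + 2) (n + 1)).hom),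
      Submodule.subtype _, p, hP _, module_projective (P.projective _), Subtype.val_injective,
      fun x => ?_, fun x => ?_, n + 1, Submodule.subtype _, Subtype.val_injective,
      Submodule.range_subtype _⟩
    · rw [← map_eq_zero_iff i hi, hpi, Submodule.coe_subtype, Subtype.range_coe]
      exact resolution_exact P n x
    · obtain ⟨y, hy⟩ : i x ∈ LinearMap.range (P.complex.d (n + 1) n).hom := hr ▸ ⟨x, rfl⟩
      exact ⟨y, hi (by rw [hpi, hy])⟩
  refine ⟨P.complex.X 0, ModuleCat.of A (LinearMap.range (P.complex.d 1 0).hom),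
    Submodule.subtype _, (P.π.f 0).hom, hP 0, module_projective (P.projective 0),
    Subtype.val_injective, fun x => ?_, (ModuleCat.epi_iff_surjective (P.π.f 0)).1 inferInstance,
    key _ ⟨0, Submodule.subtype _, Subtype.val_injective, Submodule.range_subtype _⟩⟩
  rw [Submodule.coe_subtype, Subtype.range_coe]
  exact (ShortComplex.ShortExact.moduleCat_exact_iff_function_exact _).1 P.exact₀ x

end SuperFP

/-! ### Closure properties and finite presentations -/

section SuperFPClosure

variable {A : Type u} [Ring A]

theorem superFP_of_projective (P : ModuleCat.{u} A) (h : Module.Finite A P)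
    (h' : Module.Projective A P) : SuperFP A P := by
  refine superFP_of_class (fun X => Module.Finite A X ∧ Module.Projective A X) ?_ ⟨h, h'⟩
  rintro X ⟨h, h'⟩
  exact ⟨X, ModuleCat.of A PUnit, 0, LinearMap.id, h, h', Function.injective_of_subsingleton _,
    fun x => ⟨fun hx => ⟨0, hx.symm⟩, by rintro ⟨y, rfl⟩; rfl⟩, Function.surjective_id,
    inferInstance, inferInstance⟩

theorem superFP_ring : SuperFP A (ModuleCat.of A A) :=
  superFP_of_projective _ (inferInstanceAs (Module.Finite A A))
    (inferInstanceAs (Module.Projective A A))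

theorem SuperFP.prod {X Y : ModuleCat.{u} A} (hX : SuperFP A X) (hY : SuperFP A Y) :
    SuperFP A (ModuleCat.of A (X × Y)) := by
  refine superFP_of_class (fun Z => ∃ X Y : ModuleCat.{u} A, SuperFP A X ∧ SuperFP A Y ∧
    Nonempty ((X × Y) ≃ₗ[A] Z)) ?_ ⟨X, Y, hX, hY, ⟨LinearEquiv.refl _ _⟩⟩
  rintro Z ⟨X, Y, hX, hY, ⟨e⟩⟩
  obtain ⟨P, K, i, p, _, _, hi, hip, hp, hK⟩ := hX.finiteCover
  obtain ⟨P', K', i', p', _, _, hi', hip', hp', hK'⟩ := hY.finiteCover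
  refine ⟨ModuleCat.of A (P × P'), ModuleCat.of A (K × K'), i.prodMap i',
    e.toLinearMap ∘ₗ p.prodMap p', inferInstanceAs (Module.Finite A (P × P')),
    inferInstanceAs (Module.Projective A (P × P')), hi.prodMap hi', ?_,
    e.surjective.comp (hp.prodMap hp'), K, K', hK, hK', ⟨LinearEquiv.refl _ _⟩⟩
  rintro ⟨x, y⟩
  constructor
  · intro h
    have h2 : (p x, p' y) = 0 := e.map_eq_zero_iff.1 h
    obtain ⟨a, rfl⟩ := (hip x).1 (congrArg Prod.fst h2)
    obtain ⟨b, rfl⟩ := (hip' y).1 (congrArg Prod.snd h2)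
    exact ⟨(a, b), rfl⟩
  · rintro ⟨⟨a, b⟩, h⟩
    obtain ⟨rfl, rfl⟩ := Prod.ext_iff.1 h
    exact e.map_eq_zero_iff.2 (Prod.ext (hip.apply_apply_eq_zero a) (hip'.apply_apply_eq_zero b))

theorem SuperFP.pi {X : ModuleCat.{u} A} (hX : SuperFP A X) (n : ℕ) :
    SuperFP A (ModuleCat.of A (Fin n → X)) := by
  refine superFP_of_class (fun Z => ∃ X : ModuleCat.{u} A, SuperFP A X ∧
    Nonempty ((Fin n → X) ≃ₗ[A] Z)) ?_ ⟨X, hX, ⟨LinearEquiv.refl _ _⟩⟩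
  rintro Z ⟨X, hX, ⟨e⟩⟩
  obtain ⟨P, K, i, p, _, _, hi, hip, hp, hK⟩ := hX.finiteCover
  refine ⟨ModuleCat.of A (Fin n → P), ModuleCat.of A (Fin n → K), i.compLeft (Fin n),
    e.toLinearMap ∘ₗ p.compLeft (Fin n), inferInstanceAs (Module.Finite A (Fin n → P)),
    Module.Projective.of_equiv (DirectSum.linearEquivFunOnFintype A (Fin n) fun _ => P),
    hi.comp_left, fun x => ?_,
    e.surjective.comp hp.comp_left, K, hK, ⟨LinearEquiv.refl _ _⟩⟩
  constructor
  · intro h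
    have h2 : p.compLeft (Fin n) x = 0 := e.map_eq_zero_iff.1 h
    choose a ha using fun k => (hip (x k)).1 (congrFun h2 k)
    exact ⟨a, funext ha⟩
  · rintro ⟨a, rfl⟩
    exact e.map_eq_zero_iff.2 (funext fun k => hip.apply_apply_eq_zero (a k))

/-- An extension of super finitely presented modules is a cokernel of an injection of such. -/
theorem exists_presentation_of_extension {X L Y : ModuleCat.{u} A} (hX : SuperFP A X)
    (hY : SuperFP A Y) (j : Y →ₗ[A] L) (q : L →ₗ[A] X) (hj : Function.Injective j)
    (hjq : Function.Exact j q) (hq : Function.Surjective q) :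
    ∃ (V W : ModuleCat.{u} A) (i : V →ₗ[A] W) (p : W →ₗ[A] L), SuperFP A V ∧ SuperFP A W ∧
      Function.Injective i ∧ Function.Exact i p ∧ Function.Surjective p := by
  obtain ⟨Q, K, k, s, hQ, hQ', hk, hks, hs, hK⟩ := hX.finiteCover
  obtain ⟨t, ht⟩ := Module.projective_lifting_property q s hq
  have ht' : ∀ x, q (t x) = s x := fun x => LinearMap.congr_fun ht x
  have hmem : ∀ x, (t ∘ₗ k) x ∈ LinearMap.range j := fun x =>
    (hjq _).1 ((ht' _).trans (hks.apply_apply_eq_zero x))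
  let v : K →ₗ[A] Y :=
    (LinearEquiv.ofInjective j hj).symm.toLinearMap ∘ₗ (t ∘ₗ k).codRestrict _ hmem
  have hv : ∀ x, j (v x) = t (k x) := fun x =>
    congrArg Subtype.val ((LinearEquiv.ofInjective j hj).apply_symm_apply _)
  refine ⟨K, ModuleCat.of A (Q × Y), k.prod (-v), t.coprod j, hK,
    -- `L` is the pushout of `k : K → Q` and `v : K → Y`, that is, `Q × Y` modulo the pairs `(k a,
    -- -v a)`.
    (superFP_of_projective Q hQ hQ').prod hY, fun a b h => hk (congrArg Prod.fst h), ?_, ?_⟩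
  · rintro ⟨x, y⟩
    constructor
    · intro h
      have h1 : t x + j y = 0 := h
      have h2 : s x = 0 := by
        have := congrArg q h1
        rwa [map_add, ht', hjq.apply_apply_eq_zero, add_zero, map_zero] at this
      obtain ⟨a, rfl⟩ := (hks x).1 h2
      refine ⟨a, Prod.ext rfl (hj ?_)⟩
      change j (-v a) = j y
      rw [map_neg, hv, neg_eq_iff_add_eq_zero, h1]
    · rintro ⟨a, h⟩
      obtain ⟨rfl, rfl⟩ := Prod.ext_iff.1 h
      change t (k a) + j (-v a) = 0
      rw [map_neg, hv, add_neg_cancel]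
  · intro l
    obtain ⟨x, hx⟩ := hs (q l)
    obtain ⟨y, hy⟩ := (hjq (l - t x)).1 (by rw [map_sub, ht', hx, sub_self])
    refine ⟨(x, y), ?_⟩
    change t x + j y = l
    rw [hy, add_sub_cancel]

/-- The cokernel of an injection of super finitely presented modules is super finitely presented. -/
theorem SuperFP.cokernel {X Y Z : ModuleCat.{u} A} (hX : SuperFP A X) (hY : SuperFP A Y)
    (i : X →ₗ[A] Y) (p : Y →ₗ[A] Z) (hi : Function.Injective i) (hip : Function.Exact i p)
    (hp : Function.Surjective p) : SuperFP A Z := by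
  refine superFP_of_class (fun Z => ∃ (X Y : ModuleCat.{u} A) (i : X →ₗ[A] Y) (p : Y →ₗ[A] Z),
    SuperFP A X ∧ SuperFP A Y ∧ Function.Injective i ∧ Function.Exact i p ∧
      Function.Surjective p) ?_ ⟨X, Y, i, p, hX, hY, hi, hip, hp⟩
  rintro Z ⟨X, Y, i, p, hX, hY, hi, hip, hp⟩
  obtain ⟨P, K, j, q, hP, hP', hj, hjq, hq, hK⟩ := hY.finiteCover
  -- The new syzygy `L` is an extension `0 → K → L → X → 0`, hence itself the cokernel of an
  -- injection of super finitely presented modules; this closes the coinduction.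
  let L := LinearMap.ker (p ∘ₗ q)
  have hmem : ∀ x : L, (q ∘ₗ L.subtype) x ∈ LinearMap.range i := fun x => (hip _).1 x.2
  let w : L →ₗ[A] X :=
    (LinearEquiv.ofInjective i hi).symm.toLinearMap ∘ₗ (q ∘ₗ L.subtype).codRestrict _ hmem
  have hw : ∀ x, i (w x) = q x := fun x =>
    congrArg Subtype.val ((LinearEquiv.ofInjective i hi).apply_symm_apply _)
  let j' : K →ₗ[A] L := j.codRestrict L fun x => by
    rw [LinearMap.mem_ker, LinearMap.comp_apply, hjq.apply_apply_eq_zero, map_zero]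
  refine ⟨P, ModuleCat.of A L, L.subtype, p ∘ₗ q, hP, hP', Subtype.val_injective, fun x => ?_,
    hp.comp hq, exists_presentation_of_extension hX hK j' w
      (fun a b h => hj (congrArg Subtype.val h)) (fun x => ?_) fun x => ?_⟩
  · rw [Submodule.coe_subtype, Subtype.range_coe]; exact Iff.rfl
  · rw [← map_eq_zero_iff i hi, hw, hjq]
    constructor
    · rintro ⟨y, hy⟩; exact ⟨y, Subtype.ext hy⟩
    · rintro ⟨y, rfl⟩; exact ⟨y, rfl⟩
  · obtain ⟨y, hy⟩ := hq (i x)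
    exact ⟨⟨y, by rw [LinearMap.mem_ker, LinearMap.comp_apply, hy, hip.apply_apply_eq_zero]⟩,
      hi (by rw [hw, hy])⟩

theorem SuperFP.finitePresentation {M : ModuleCat.{u} A} (hM : SuperFP A M) :
    Module.FinitePresentation A M := by
  obtain ⟨P, K, i, p, _, _, hi, hip, hp, hK⟩ := hM.finiteCover
  obtain ⟨P', _, _, p', _, _, _, _, hp', _⟩ := hK.finiteCover
  have := Module.finitePresentation_of_projective A P
  have : Module.Finite A K := Module.Finite.of_surjective p' hp'
  refine Module.finitePresentation_of_surjective p hp ?_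
  rw [LinearMap.exact_iff.1 hip]
  exact Submodule.fg_range _

/-- `M` is presented by the generators `c` and the relations `r`. -/
structure IsPresentedBy (M : Type u) [AddCommGroup M] [Module A M] {n m : ℕ} (c : Fin n → M)
    (r : Fin m → Fin n → A) : Prop where
  exists_eq_sum : ∀ x, ∃ a : Fin n → A, x = ∑ i, a i • c i
  relation : ∀ j, ∑ i, r j i • c i = 0
  exists_of_sum_eq_zero : ∀ a : Fin n → A, ∑ i, a i • c i = 0 →
    ∃ b : Fin m → A, ∀ i, a i = ∑ j, b j * r j i

theorem exists_isPresentedBy (M : Type u) [AddCommGroup M] [Module A M]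
    [Module.FinitePresentation A M] : ∃ (n m : ℕ) (c : Fin n → M) (r : Fin m → Fin n → A),
      IsPresentedBy M c r := by
  obtain ⟨n, f, hf⟩ := Module.Finite.exists_fin' A M
  have hK : (LinearMap.ker f).FG := Module.FinitePresentation.fg_ker f hf
  obtain ⟨m, r, hr⟩ := Submodule.fg_iff_exists_fin_generating_family.1 hK
  have hfs : ∀ a : Fin n → A, f a = ∑ i, a i • f (Pi.single i 1) := fun a => by
    conv_lhs => rw [pi_eq_sum_univ' a]
    simp
  refine ⟨n, m, fun i => f (Pi.single i 1), r, fun x => ?_, fun j => ?_, fun a ha => ?_⟩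
  · obtain ⟨a, rfl⟩ := hf x
    exact ⟨a, hfs a⟩
  · rw [← hfs]
    exact LinearMap.mem_ker.1 (hr ▸ Submodule.subset_span ⟨j, rfl⟩)
  · rw [← hfs, ← LinearMap.mem_ker, ← hr, Submodule.mem_span_range_iff_exists_fun] at ha
    obtain ⟨b, rfl⟩ := ha
    exact ⟨b, fun i => by simp [Finset.sum_apply]⟩

end SuperFPClosure

/-! ### Weak injective coefficients over a bimodule -/

section Presentation

variable {A B C : Type u} [Ring A] [Ring B] [AddCommGroup C] [Module A C] [Module B C]

/-- A `B`-linear map out of a presented module is given by images of the generators that satisfy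
the relations. -/
theorem IsPresentedBy.exists_linearMap {D : Type u} [AddCommGroup D] [Module B D] {n m : ℕ}
    {c : Fin n → C} {r : Fin m → Fin n → B} (h : IsPresentedBy C c r) (x : Fin n → D)
    (hx : ∀ j, ∑ i, r j i • x i = 0) : ∃ φ : C →ₗ[B] D, ∀ i, φ (c i) = x i := by
  let F := Fintype.linearCombination B c
  let G := Fintype.linearCombination B x
  have hF : Function.Surjective F := fun y => by
    obtain ⟨a, rfl⟩ := h.exists_eq_sum y
    exact ⟨a, Fintype.linearCombination_apply B c a⟩
  have hker : LinearMap.ker F ≤ LinearMap.ker G := fun a ha => by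
    obtain ⟨b, hb⟩ := h.exists_of_sum_eq_zero a ha
    change ∑ i, a i • x i = 0
    simp_rw [hb, Finset.sum_smul, mul_smul]
    rw [Finset.sum_comm]
    simp_rw [← Finset.smul_sum, hx, smul_zero, Finset.sum_const_zero]
  refine ⟨(LinearMap.ker F).liftQ G hker ∘ₗ (F.quotKerEquivOfSurjective hF).symm.toLinearMap,
    fun i => ?_⟩
  have hFi : F (Pi.single i 1) = c i := by simp [F]
  have hGi : G (Pi.single i 1) = x i := by simp [G]
  rw [← hFi, LinearMap.comp_apply, LinearEquiv.coe_coe,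
    LinearMap.quotKerEquivOfSurjective_symm_apply, Submodule.liftQ_apply, hGi]

/-- Two maps out of a presented module agree as soon as they agree on the generators. -/
theorem IsPresentedBy.ext {D : Type u} [AddCommGroup D] [Module B D] {n m : ℕ}
    {c : Fin n → C} {r : Fin m → Fin n → B} (h : IsPresentedBy C c r) {φ ψ : C →ₗ[B] D}
    (hφ : ∀ i, φ (c i) = ψ (c i)) : φ = ψ := by
  ext x
  obtain ⟨a, rfl⟩ := h.exists_eq_sum x
  simp [hφ]

variable [SMulCommClass A B C] {n m : ℕ} {c : Fin n → C} {r : Fin m → Fin n → B}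

/-- Let `C` be super finitely presented over `A`, presented over `B` and with `A = End_B(C)`.
Every element of a weak injective `A`-module `I` is `∑ fᵢ(cᵢ)` with `fᵢ : C → I`, and the
relations between these sums come from the relations between the `cᵢ`. -/
theorem WeakInjective.presentation_exact (hC : SuperFP A (ModuleCat.of A C))
    (hp : IsPresentedBy C c r) (hinj : ∀ a : A, (∀ x : C, a • x = 0) → a = 0)
    (hsurj : ∀ φ : C →ₗ[B] C, ∃ a : A, ∀ x, φ x = a • x) {I : Type u} [AddCommGroup I] [Module A I]
    (hI : WeakInjective A I) :
    (∀ x : I, ∃ f : Fin n → (C →ₗ[A] I), ∑ i, f i (c i) = x) ∧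
    ∀ f : Fin n → (C →ₗ[A] I), ∑ i, f i (c i) = 0 →
      ∃ g : Fin m → (C →ₗ[A] I), ∀ i x, f i x = ∑ j, g j (r j i • x) := by
  have : SMulCommClass B A C := SMulCommClass.symm A B C
  -- `ι` and `ρ` arise from `Bᵐ → Bⁿ → C` by applying `Hom_B(-, C)` and identifying `End_B(C)` with
  -- `A`, so `0 → A → Cⁿ → Cᵐ` is exact.
  let ι : A →ₗ[A] (Fin n → C) := LinearMap.pi fun i => LinearMap.toSpanSingleton A C (c i)
  let ρ : (Fin n → C) →ₗ[A] (Fin m → C) :=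
    { toFun := fun x j => ∑ i, r j i • x i
      map_add' := fun x y => by ext j; simp [smul_add, Finset.sum_add_distrib]
      map_smul' := fun a x => by ext j; simp [Finset.smul_sum, smul_comm a] }
  have hι : Function.Injective ι := (injective_iff_map_eq_zero ι).2 fun a ha =>
    hinj a fun x => by
      obtain ⟨b, rfl⟩ := hp.exists_eq_sum x
      have h : ∀ i, a • c i = 0 := fun i => congrFun ha i
      simp_rw [Finset.smul_sum, smul_comm a, h, smul_zero, Finset.sum_const_zero]
  have hρι : LinearMap.ker ρ = LinearMap.range ι := by
    apply le_antisymm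
    · intro x hx
      obtain ⟨φ, hφ⟩ := hp.exists_linearMap x fun j => congrFun hx j
      obtain ⟨a, ha⟩ := hsurj φ
      exact ⟨a, funext fun i => (ha (c i)).symm.trans (hφ i)⟩
    · rintro _ ⟨a, rfl⟩
      refine funext fun j => ?_
      change ∑ i, r j i • a • c i = 0
      simp_rw [← smul_comm a, ← Finset.smul_sum, hp.relation, smul_zero]
  let K := (Fin n → C) ⧸ LinearMap.range ι
  have hKex : Function.Exact ι (LinearMap.range ι).mkQ := LinearMap.exact_map_mkQ_range ι
  -- Maps into `I` extend along `A → Cⁿ` and along `K → Cᵐ` because both cokernels are super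
  -- finitely presented.
  have hK : SuperFP A (ModuleCat.of A K) :=
    superFP_ring.cokernel (hC.pi n) ι (LinearMap.range ι).mkQ hι hKex (Submodule.mkQ_surjective _)
  let ρ' : K →ₗ[A] (Fin m → C) := (LinearMap.range ι).liftQ ρ hρι.ge
  have hρ' : Function.Injective ρ' :=
    LinearMap.ker_eq_bot.1 (Submodule.ker_liftQ_eq_bot' _ _ hρι.symm)
  have hKex' : Function.Exact ρ' (LinearMap.range ρ').mkQ := LinearMap.exact_map_mkQ_range ρ'
  have hK' : SuperFP A (ModuleCat.of A ((Fin m → C) ⧸ LinearMap.range ρ')) :=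
    hK.cokernel (hC.pi m) ρ' (LinearMap.range ρ').mkQ hρ' hKex' (Submodule.mkQ_surjective _)
  refine ⟨fun x => ?_, fun f hf => ?_⟩
  -- Extend `1 ↦ x` along `ι`; since `ι 1 = c`, the components of the extension at the `cᵢ` sum to
  -- `x`.
  · obtain ⟨g, hg⟩ := hI.exists_extension ι (LinearMap.range ι).mkQ hι hKex
      (Submodule.mkQ_surjective _) hK (LinearMap.toSpanSingleton A I x)
    refine ⟨fun i => g ∘ₗ LinearMap.single A (fun _ => C) i, ?_⟩
    have h1 := LinearMap.congr_fun hg 1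
    have h2 : ι 1 = c := funext fun i => one_smul A (c i)
    rw [LinearMap.comp_apply, h2, LinearMap.toSpanSingleton_apply, one_smul] at h1
    conv_rhs => rw [← h1, ← Finset.univ_sum_single c, map_sum]
    rfl
  -- `F` kills the image of `A`, so it descends to `K` and extends to `Cᵐ`; the components of that
  -- extension are the `gⱼ`.
  · let F : (Fin n → C) →ₗ[A] I := ∑ i, f i ∘ₗ LinearMap.proj i
    have hF : ∀ x, F x = ∑ i, f i (x i) := fun x => by simp [F]
    have hFι : LinearMap.range ι ≤ LinearMap.ker F := by
      rintro _ ⟨a, rfl⟩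
      rw [LinearMap.mem_ker, hF]
      change ∑ i, f i (a • c i) = 0
      simp_rw [map_smul, ← Finset.smul_sum, hf, smul_zero]
    obtain ⟨g, hg⟩ := hI.exists_extension ρ' (LinearMap.range ρ').mkQ hρ' hKex'
      (Submodule.mkQ_surjective _) hK' ((LinearMap.range ι).liftQ F hFι)
    refine ⟨fun j => g ∘ₗ LinearMap.single A (fun _ => C) j, fun i x => ?_⟩
    have h1 : g (ρ (Pi.single i x)) = F (Pi.single i x) :=
      LinearMap.congr_fun hg (Submodule.Quotient.mk (Pi.single i x))
    have h2 : ρ (Pi.single i x) = fun j => r j i • x := funext fun j => by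
      change ∑ k, r j k • (Pi.single i x : Fin n → C) k = _
      rw [Finset.sum_eq_single i (fun k _ hk => by rw [Pi.single_eq_of_ne hk, smul_zero])
        (by simp), Pi.single_eq_same]
    have h3 : F (Pi.single i x) = f i x := by
      rw [hF, Finset.sum_eq_single i (fun k _ hk => by rw [Pi.single_eq_of_ne hk, map_zero])
        (by simp), Pi.single_eq_same]
    rw [← h3, ← h1, h2, ← Finset.univ_sum_single (fun j => r j i • x), map_sum]
    rfl

end Presentation

/-! ### Characters of abelian groups -/

/-- The group `ℚ/ℤ`. -/
abbrev QZ : Type := AddCircle (1 : ℚ)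

section Characters

universe v

variable {X Y Z : Type v} [AddCommGroup X] [AddCommGroup Y] [AddCommGroup Z]

theorem exists_character_extension (i : X →+ Y) (hi : Function.Injective i) (φ : X →+ QZ) :
    ∃ ψ : Y →+ QZ, ∀ x, ψ (i x) = φ x := by
  obtain ⟨ψ, hψ⟩ := CharacterModule.dual_surjective_of_injective i.toIntLinearMap hi φ
  exact ⟨ψ, fun x => DFunLike.congr_fun hψ x⟩

theorem exists_character_ne_zero {x : X} (hx : x ≠ 0) : ∃ φ : X →+ QZ, φ x ≠ 0 :=
  CharacterModule.exists_character_apply_ne_zero_of_ne_zero hx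

theorem exists_character_of_notMem_range (f : X →+ Y) {y : Y} (hy : y ∉ f.range) :
    ∃ φ : Y →+ QZ, (∀ x, φ (f x) = 0) ∧ φ y ≠ 0 := by
  obtain ⟨φ, hφ⟩ := exists_character_ne_zero (x := (y : Y ⧸ f.range))
    (by rwa [Ne, QuotientAddGroup.eq_zero_iff])
  refine ⟨φ.comp (QuotientAddGroup.mk' _), fun x => ?_, hφ⟩
  have : (QuotientAddGroup.mk' f.range) (f x) = 0 := (QuotientAddGroup.eq_zero_iff _).2 ⟨x, rfl⟩
  rw [AddMonoidHom.comp_apply, this, map_zero]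

/-- A character that vanishes on `ker g` factors through `g`. -/
theorem exists_character_factor (g : Y →+ Z) (φ : Y →+ QZ) (h : ∀ y, g y = 0 → φ y = 0) :
    ∃ ψ : Z →+ QZ, ∀ y, ψ (g y) = φ y := by
  obtain ⟨ψ, hψ⟩ := exists_character_extension (QuotientAddGroup.kerLift g)
    (QuotientAddGroup.kerLift_injective g) (QuotientAddGroup.lift g.ker φ h)
  exact ⟨ψ, fun y => hψ y⟩

/-- Injectivity of ℚ/ℤ gives the forward direction; conversely, a point of the kernel outside the
image would be separated from the image by a character. -/
theorem exact_iff_characters (f : X →+ Y) (g : Y →+ Z) (h : ∀ x, g (f x) = 0) :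
    Function.Exact f g ↔ ∀ φ : Y →+ QZ, (∀ x, φ (f x) = 0) →
      ∃ ψ : Z →+ QZ, ∀ y, ψ (g y) = φ y := by
  constructor
  · intro hfg φ hφ
    refine exists_character_factor g φ fun y hy => ?_
    obtain ⟨x, rfl⟩ := (hfg y).1 hy
    exact hφ x
  · intro H y
    refine ⟨fun hy => ?_, by rintro ⟨x, rfl⟩; exact h x⟩
    by_contra hr
    obtain ⟨φ, hφ, hne⟩ := exists_character_of_notMem_range f hr
    obtain ⟨ψ, hψ⟩ := H φ hφ
    exact hne (by rw [← hψ, hy, map_zero])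

/-- A nonzero kernel element contradicts surjectivity of the dual map, and a nonzero cokernel
element contradicts its injectivity. -/
theorem bijective_of_dual_bijective (f : X →+ Y)
    (h : Function.Bijective fun φ : Y →+ QZ => φ.comp f) : Function.Bijective f := by
  constructor
  · refine (injective_iff_map_eq_zero f).2 fun x hx => ?_
    by_contra hne
    obtain ⟨φ, hφ⟩ := exists_character_ne_zero hne
    obtain ⟨ψ, rfl⟩ := h.2 φ
    exact hφ (by rw [AddMonoidHom.comp_apply, hx, map_zero])
  · intro y
    by_contra hy
    obtain ⟨φ, hφ, hne⟩ := exists_character_of_notMem_range f hy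
    have : φ = 0 := h.1 (by ext x; exact hφ x)
    exact hne (by rw [this]; rfl)

end Characters

/-! ### Character modules -/

section CharModule

variable (R : Type u) [Ring R]

/-- The underlying group of a character module. -/
def charEquiv (M : Type u) [AddCommGroup M] [Module R M] : charModule R M ≃+ (M →+ QZ) :=
  AddEquiv.refl _

@[simp] theorem charEquiv_smul (M : Type u) [AddCommGroup M] [Module R M] (a : Rᵐᵒᵖ)
    (φ : charModule R M) (m : M) :
    charEquiv R M (a • φ) m = charEquiv R M φ (a.unop • m) := rfl

/-- For a right `R`-module `M`, the left `R`-module `Hom_ℤ(M, ℚ/ℤ)`. -/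
def leftChar (M : Type u) [AddCommGroup M] [Module Rᵐᵒᵖ M] : ModuleCat.{u} R :=
  letI : Module R (M →+ QZ) :=
    { smul := fun a f => f.comp (DistribSMul.toAddMonoidHom M (op a))
      smul_add := fun a f g => by ext m; rfl
      smul_zero := fun a => by ext m; rfl
      zero_smul := fun f => by
        ext m
        change f ((0 : Rᵐᵒᵖ) • m) = 0
        rw [zero_smul, map_zero]
      add_smul := fun a b f => by
        ext m
        change f ((op a + op b) • m) = f (op a • m) + f (op b • m)
        rw [add_smul, map_add]
      mul_smul := fun a b f => by
        ext m
        change f ((op b * op a) • m) = f (op b • op a • m)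
        rw [mul_smul]
      one_smul := fun f => by
        ext m
        change f ((1 : Rᵐᵒᵖ) • m) = f m
        rw [one_smul] }
  ModuleCat.of R (M →+ QZ)

/-- The underlying group of a left character module. -/
def leftCharEquiv (M : Type u) [AddCommGroup M] [Module Rᵐᵒᵖ M] : leftChar R M ≃+ (M →+ QZ) :=
  AddEquiv.refl _

@[simp] theorem leftCharEquiv_smul (M : Type u) [AddCommGroup M] [Module Rᵐᵒᵖ M] (a : R)
    (φ : leftChar R M) (m : M) :
    leftCharEquiv R M (a • φ) m = leftCharEquiv R M φ (op a • m) := rfl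

/-- The map of character modules induced by a linear map. -/
def charMap {M N : Type u} [AddCommGroup M] [Module R M] [AddCommGroup N] [Module R N]
    (f : M →ₗ[R] N) : charModule R N →ₗ[Rᵐᵒᵖ] charModule R M where
  toFun φ := (charEquiv R M).symm ((charEquiv R N φ).comp f.toAddMonoidHom)
  map_add' _ _ := rfl
  map_smul' r φ := (charEquiv R M).injective <| by
    ext m; exact congrArg (charEquiv R N φ) (map_smul f r.unop m).symm

@[simp] theorem charMap_apply {M N : Type u} [AddCommGroup M] [Module R M] [AddCommGroup N]
    [Module R N] (f : M →ₗ[R] N) (φ : charModule R N) (m : M) :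
    charEquiv R M (charMap R f φ) m = charEquiv R N φ (f m) := rfl

/-- The isomorphism of character modules induced by an isomorphism. -/
def charCongr {M N : Type u} [AddCommGroup M] [Module R M] [AddCommGroup N] [Module R N]
    (e : M ≃ₗ[R] N) : charModule R N ≃ₗ[Rᵐᵒᵖ] charModule R M :=
  LinearEquiv.ofLinearMap (charMap R e.toLinearMap) (charMap R e.symm.toLinearMap)
    (by ext φ; exact (charEquiv R M).injective (by ext m; simp))
    (by ext φ; exact (charEquiv R N).injective (by ext m; simp))

end CharModule

/-! ### Tensor products -/

section TensorProduct

variable {R : Type u} [Ring R]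
variable {M : Type u} [AddCommGroup M] [Module Rᵐᵒᵖ M] {N : Type u} [AddCommGroup N] [Module R N]

theorem tens_induction {p : Tens R M N → Prop} (z : Tens R M N) (zero : p 0)
    (tmul : ∀ m n, p (tmul R m n)) (add : ∀ x y, p x → p y → p (x + y)) : p z := by
  obtain ⟨y, rfl⟩ := QuotientAddGroup.mk'_surjective _ z
  induction y with
  | zero => rwa [map_zero]
  | tmul m n => exact tmul m n
  | add x y hx hy => rw [map_add]; exact add _ _ hx hy

/-- The map out of `M ⊗_R N` given by a balanced biadditive map. -/
def tlift {P : Type*} [AddCommGroup P] (b : M →+ N →+ P)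
    (hb : ∀ (r : R) m n, b (op r • m) n = b m (r • n)) : Tens R M N →+ P :=
  QuotientAddGroup.lift _ (TensorProduct.liftAddHom (R := ℤ) b fun r m n => by
    rw [map_zsmul, map_zsmul, AddMonoidHom.zsmul_apply]) <| by
    rw [balancing, AddSubgroup.closure_le]
    rintro _ ⟨m, r, n, rfl⟩
    rw [SetLike.mem_coe, AddMonoidHom.mem_ker, map_sub]
    exact sub_eq_zero.2 (hb r m n)

@[simp] theorem tlift_tmul {P : Type*} [AddCommGroup P] (b : M →+ N →+ P)
    (hb : ∀ (r : R) m n, b (op r • m) n = b m (r • n)) (m : M) (n : N) :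
    tlift b hb (tmul R m n) = b m n := rfl

theorem tmul_sum {ι : Type*} (s : Finset ι) (m : M) (n : ι → N) :
    tmul R m (∑ i ∈ s, n i) = ∑ i ∈ s, tmul R m (n i) :=
  map_sum (⟨⟨tmul R m, tmul_zero R m⟩, tmul_add R m⟩ : N →+ Tens R M N) n s

theorem sum_tmul {ι : Type*} (s : Finset ι) (m : ι → M) (n : N) :
    tmul R (∑ i ∈ s, m i) n = ∑ i ∈ s, tmul R (m i) n :=
  map_sum (⟨⟨fun m => tmul R m n, zero_tmul R n⟩, fun m m' => add_tmul R m m' n⟩ :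
    M →+ Tens R M N) m s

theorem exists_tens_eq_sum_right {k : ℕ} {c : Fin k → N}
    (hc : ∀ x, ∃ a : Fin k → R, x = ∑ i, a i • c i) (z : Tens R M N) :
    ∃ x : Fin k → M, z = ∑ i, tmul R (x i) (c i) := by
  induction z using tens_induction with
  | zero => exact ⟨0, by simp [zero_tmul]⟩
  | tmul m n =>
    obtain ⟨a, rfl⟩ := hc n
    exact ⟨fun i => op (a i) • m, by simp_rw [tmul_sum, smul_tmul]⟩
  | add x y hx hy =>
    obtain ⟨x, rfl⟩ := hx
    obtain ⟨y, rfl⟩ := hy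
    exact ⟨x + y, by simp [add_tmul, Finset.sum_add_distrib]⟩

/-- A character of `M ⊗_R N` as a homomorphism `M → N⁺`. -/
def curryRight : (Tens R M N →+ QZ) ≃+ (M →ₗ[Rᵐᵒᵖ] charModule R N) where
  toFun Ψ :=
    { toFun := fun m => (charEquiv R N).symm
        ⟨⟨fun n => Ψ (tmul R m n), by rw [tmul_zero, map_zero]⟩, fun n n' =>
          (congrArg Ψ (tmul_add R m n n')).trans (map_add _ _ _)⟩
      map_add' := fun m m' => (charEquiv R N).injective <| by
        ext n; exact (congrArg Ψ (add_tmul R m m' n)).trans (map_add _ _ _)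
      map_smul' := fun r m => (charEquiv R N).injective <| by
        ext n; exact congrArg Ψ (smul_tmul R r.unop m n) }
  invFun f := tlift ((charEquiv R N).toAddMonoidHom.comp f.toAddMonoidHom) fun r m n => by
    change charEquiv R N (f (op r • m)) n = _
    rw [map_smul]; rfl
  left_inv Ψ := tens_hom_ext R fun m n => rfl
  right_inv f := by ext m; exact (charEquiv R N).injective (by ext n; rfl)
  map_add' Ψ Ψ' := by ext m; exact (charEquiv R N).injective (by ext n; rfl)

@[simp] theorem curryRight_apply (Ψ : Tens R M N →+ QZ) (m : M) (n : N) :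
    charEquiv R N (curryRight Ψ m) n = Ψ (tmul R m n) := rfl

@[simp] theorem curryRight_symm_tmul (f : M →ₗ[Rᵐᵒᵖ] charModule R N) (m : M) (n : N) :
    curryRight.symm f (tmul R m n) = charEquiv R N (f m) n := rfl

/-- A character of `M ⊗_R N` as a homomorphism `N → M⁺`. -/
def curryLeft : (Tens R M N →+ QZ) ≃+ (N →ₗ[R] leftChar R M) where
  toFun Ψ :=
    { toFun := fun n => (leftCharEquiv R M).symm
        ⟨⟨fun m => Ψ (tmul R m n), by rw [zero_tmul, map_zero]⟩, fun m m' =>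
          (congrArg Ψ (add_tmul R m m' n)).trans (map_add _ _ _)⟩
      map_add' := fun n n' => (leftCharEquiv R M).injective <| by
        ext m; exact (congrArg Ψ (tmul_add R m n n')).trans (map_add _ _ _)
      map_smul' := fun r n => (leftCharEquiv R M).injective <| by
        ext m; exact congrArg Ψ (smul_tmul R r m n).symm }
  invFun f := tlift ((leftCharEquiv R M).toAddMonoidHom.comp f.toAddMonoidHom).flip
    fun r m n => by
      change leftCharEquiv R M (f n) (op r • m) = leftCharEquiv R M (f (r • n)) m
      rw [map_smul f r n]; rfl
  left_inv Ψ := tens_hom_ext R fun m n => rfl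
  right_inv f := by ext m; exact (leftCharEquiv R M).injective (by ext n; rfl)
  map_add' Ψ Ψ' := by ext m; exact (leftCharEquiv R M).injective (by ext n; rfl)

@[simp] theorem curryLeft_apply (Ψ : Tens R M N →+ QZ) (m : M) (n : N) :
    leftCharEquiv R M (curryLeft Ψ n) m = Ψ (tmul R m n) := rfl

@[simp] theorem curryLeft_symm_tmul (f : N →ₗ[R] leftChar R M) (m : M) (n : N) :
    curryLeft.symm f (tmul R m n) = leftCharEquiv R M (f n) m := rfl

end TensorProduct

/-! ### The comparison `I⁺ ⊗ M → Hom(M, I)⁺` -/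

section CharTens

variable {S : Type u} [Ring S] (I : Type u) [AddCommGroup I] [Module S I]

/-- The map `I⁺ ⊗ M → Hom(M, I)⁺`, `φ ⊗ m ↦ (f ↦ φ (f m))`. -/
def charTens (M : Type u) [AddCommGroup M] [Module S M] :
    Tens S (charModule S I) M →+ ((M →ₗ[S] I) →+ QZ) :=
  tlift
    { toFun := fun φ =>
        { toFun := fun m => (charEquiv S I φ).comp
            (LinearMap.applyₗ' ℕ m : (M →ₗ[S] I) →ₗ[ℕ] I).toAddMonoidHom
          map_zero' := by ext f; simp
          map_add' := fun m m' => by ext f; simp }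
      map_zero' := by ext; simp
      map_add' := fun φ ψ => by ext; simp }
    fun r φ m => by ext f; simp

@[simp] theorem charTens_tmul {M : Type u} [AddCommGroup M] [Module S M] (φ : charModule S I)
    (m : M) (f : M →ₗ[S] I) : charTens I M (tmul S φ m) f = charEquiv S I φ (f m) := rfl

/-- Needed both to compare the complexes computing Tor and Ext and to make the comparison
`Rᵐᵒᵖ`-linear for `M = C`. -/
theorem charTens_naturality {M M' : Type u} [AddCommGroup M] [Module S M] [AddCommGroup M']
    [Module S M'] (g : M →ₗ[S] M') (z : Tens S (charModule S I) M) (f : M' →ₗ[S] I) :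
    charTens I M' (tmap S LinearMap.id g z) f = charTens I M z (f ∘ₗ g) := by
  induction z using tens_induction with
  | zero => simp
  | tmul φ m => simp
  | add x y hx hy => simp [hx, hy]

/-- A character of `Iᵏ` is a sum of characters of `I`. -/
theorem character_pi_apply {k : ℕ} {X : Type u} [AddCommGroup X] (Φ : (Fin k → X) →+ QZ)
    (x : Fin k → X) :
    Φ x = ∑ i, (Φ.comp (AddMonoidHom.single (fun _ => X) i)) (x i) := by
  conv_lhs => rw [← Finset.univ_sum_single x, map_sum]
  rfl

/-- Both `I⁺ ⊗ -` and `Hom(-, I)⁺` are right exact and agree on finite free modules. The argument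
spells this out on generators and relations. -/
theorem charTens_bijective (M : Type u) [AddCommGroup M] [Module S M]
    [Module.FinitePresentation S M] : Function.Bijective (charTens (S := S) I M) := by
  obtain ⟨n, m, c, r, hp⟩ := exists_isPresentedBy (A := S) M
  constructor
  · refine (injective_iff_map_eq_zero _).2 fun z hz => ?_
    obtain ⟨φ, rfl⟩ := exists_tens_eq_sum_right (R := S) hp.exists_eq_sum z
    have hφ : ∀ f : M →ₗ[S] I, ∑ i, charEquiv S I (φ i) (f (c i)) = 0 := fun f => by
      have := DFunLike.congr_fun hz f
      simpa [AddMonoidHom.finsetSum_apply] using this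
    let ρ : (Fin n → I) →+ (Fin m → I) :=
      { toFun := fun x j => ∑ i, r j i • x i
        map_zero' := by ext; simp
        map_add' := fun x y => by ext; simp [Finset.sum_add_distrib] }
    let Φ : (Fin n → I) →+ QZ :=
      ∑ i, (charEquiv S I (φ i)).comp (Pi.evalAddMonoidHom (fun _ => I) i)
    have hΦ : ∀ x, Φ x = ∑ i, charEquiv S I (φ i) (x i) := fun x => by
      simp [Φ]
    -- The kernel of `ρ` consists of the value tuples `(f (cᵢ))` of maps `f : M → I`, and `Φ`
    -- vanishes on them by `hφ`.
    obtain ⟨Ψ, hΨ⟩ := exists_character_factor ρ Φ fun x hx => by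
      obtain ⟨f, hf⟩ := hp.exists_linearMap x fun j => congrFun hx j
      rw [hΦ, ← hφ f]
      simp_rw [hf]
    let ψ : Fin m → charModule S I := fun j =>
      (charEquiv S I).symm (Ψ.comp (AddMonoidHom.single (fun _ => I) j))
    have key : ∀ i, φ i = ∑ j, op (r j i) • ψ j := fun i => (charEquiv S I).injective <| by
      ext x
      have h1 : Φ (Pi.single i x) = charEquiv S I (φ i) x := by
        rw [hΦ, Finset.sum_eq_single i (fun k _ hk => by rw [Pi.single_eq_of_ne hk, map_zero])
          (by simp), Pi.single_eq_same]
      have h2 : ρ (Pi.single i x) = fun j => r j i • x := funext fun j => by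
        change ∑ k, r j k • (Pi.single i x : Fin n → I) k = _
        rw [Finset.sum_eq_single i (fun k _ hk => by rw [Pi.single_eq_of_ne hk, smul_zero])
          (by simp), Pi.single_eq_same]
      rw [← h1, ← hΨ, h2, character_pi_apply, map_sum, AddMonoidHom.finsetSum_apply]
      rfl
    simp_rw [key, sum_tmul, smul_tmul]
    rw [Finset.sum_comm]
    simp_rw [← tmul_sum, hp.relation, tmul_zero, Finset.sum_const_zero]
  · intro Φ
    let ev : (M →ₗ[S] I) →+ (Fin n → I) :=
      { toFun := fun f i => f (c i)
        map_zero' := rfl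
        map_add' := fun _ _ => rfl }
    -- Evaluation at the generators embeds `Hom(M, I)` in `Iⁿ`; the components of an extended
    -- character are the coefficients of the preimage.
    obtain ⟨Ψ, hΨ⟩ := exists_character_extension ev
      (fun f g h => hp.ext fun i => congrFun h i) Φ
    refine ⟨∑ i, tmul S ((charEquiv S I).symm (Ψ.comp (AddMonoidHom.single (fun _ => I) i))) (c i),
      ?_⟩
    ext f
    rw [← hΨ, character_pi_apply, map_sum, AddMonoidHom.finsetSum_apply]
    rfl

end CharTens

/-! ### Duality between weak flat and weak injective modules -/

section Duality

variable {R : Type u} [Ring R]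

theorem resolution_d_d {A : Type u} [Ring A] {N : ModuleCat.{u} A} (P : ProjectiveResolution N)
    (x : P.complex.X 2) : (P.complex.d 1 0).hom ((P.complex.d 2 1).hom x) = 0 :=
  ConcreteCategory.congr_hom (P.complex.d_comp_d 2 1 0) x

/-- By adjunction, characters of `P ⊗ F` are maps `P → F⁺`, so the Ext complex is the character dual
of the Tor complex. No finiteness of `P` is needed. -/
theorem torR_subsingleton_iff_ext (F : Type u) [AddCommGroup F] [Module R F]
    {N : ModuleCat.{u} Rᵐᵒᵖ} (P : ProjectiveResolution N) :
    Subsingleton (TorR R F 1 N) ↔ Subsingleton (Abelian.Ext N (charModule R F) 1) := by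
  rw [torR_one_subsingleton_iff R F P, ext_one_subsingleton_iff P, exact_iff_characters]
  · constructor
    · intro h f hf
      obtain ⟨ψ, hψ⟩ := h (curryRight.symm f) fun z => by
        induction z using tens_induction with
        | zero => simp
        | tmul p x =>
          rw [tmap_tmul, curryRight_symm_tmul]
          have : f ((P.complex.d 2 1).hom p) = 0 := LinearMap.congr_fun hf p
          rw [this]; rfl
        | add x y hx hy => rw [map_add, map_add, hx, hy, add_zero]
      refine ⟨curryRight ψ, ?_⟩
      ext p
      exact (charEquiv R F).injective (by ext x; exact hψ (tmul R p x))
    · intro h φ hφ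
      obtain ⟨g, hg⟩ := h (curryRight φ) (by
        ext p
        exact (charEquiv R F).injective (by ext x; exact hφ (tmul R p x)))
      refine ⟨curryRight.symm g, fun z => ?_⟩
      induction z using tens_induction with
      | zero => simp
      | tmul p x =>
        exact DFunLike.congr_fun (congrArg (charEquiv R F) (LinearMap.congr_fun hg p)) x
      | add x y hx hy => rw [map_add, map_add, map_add, hx, hy]
  · intro z
    induction z using tens_induction with
    | zero => simp
    | tmul p x => simp [resolution_d_d, zero_tmul]
    | add x y hx hy => rw [map_add, map_add, hx, hy, add_zero]

theorem weakFlat_iff (F : Type u) [AddCommGroup F] [Module R F] :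
    WeakFlat R F ↔ WeakInjective Rᵐᵒᵖ (charModule R F) :=
  forall_congr' fun _ => forall_congr' fun hN => torR_subsingleton_iff_ext F hN.choose

theorem torL_subsingleton_iff_ext (F : Type u) [AddCommGroup F] [Module Rᵐᵒᵖ F]
    {N : ModuleCat.{u} R} (P : ProjectiveResolution N) :
    Subsingleton (TorL R F 1 N) ↔ Subsingleton (Abelian.Ext N (leftChar R F) 1) := by
  rw [torL_one_subsingleton_iff F P, ext_one_subsingleton_iff P, exact_iff_characters]
  · constructor
    · intro h f hf
      obtain ⟨ψ, hψ⟩ := h (curryLeft.symm f) fun z => by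
        induction z using tens_induction with
        | zero => simp
        | tmul x p =>
          rw [tmap_tmul, curryLeft_symm_tmul]
          have : f ((P.complex.d 2 1).hom p) = 0 := LinearMap.congr_fun hf p
          rw [this]; rfl
        | add x y hx hy => rw [map_add, map_add, hx, hy, add_zero]
      refine ⟨curryLeft ψ, ?_⟩
      ext p
      exact (leftCharEquiv R F).injective (by ext x; exact hψ (tmul R x p))
    · intro h φ hφ
      obtain ⟨g, hg⟩ := h (curryLeft φ) (by
        ext p
        exact (leftCharEquiv R F).injective (by ext x; exact hφ (tmul R x p)))
      refine ⟨curryLeft.symm g, fun z => ?_⟩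
      induction z using tens_induction with
      | zero => simp
      | tmul x p =>
        exact DFunLike.congr_fun (congrArg (leftCharEquiv R F) (LinearMap.congr_fun hg p)) x
      | add x y hx hy => rw [map_add, map_add, map_add, hx, hy]
  · intro z
    induction z using tens_induction with
    | zero => simp
    | tmul x p => simp [resolution_d_d, tmul_zero]
    | add x y hx hy => rw [map_add, map_add, hx, hy, add_zero]

theorem weakFlatRight_iff (F : Type u) [AddCommGroup F] [Module Rᵐᵒᵖ F] :
    WeakFlatRight R F ↔ WeakInjective R (leftChar R F) :=
  forall_congr' fun _ => forall_congr' fun hN => torL_subsingleton_iff_ext F hN.choose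

/-- Here finite generation matters: each `Pₙ` is finitely presented, so `I⁺ ⊗ Pₙ ≅ Hom(Pₙ, I)⁺`, and
the Tor complex is the character dual of the Ext complex. -/
theorem ext_subsingleton_iff_torL (I : Type u) [AddCommGroup I] [Module R I]
    {N : ModuleCat.{u} R} (P : ProjectiveResolution N) (hP : ∀ n, Module.Finite R (P.complex.X n)) :
    Subsingleton (Abelian.Ext N (ModuleCat.of R I) 1) ↔
      Subsingleton (TorL R (charModule R I) 1 N) := by
  have hfp : ∀ n, Module.FinitePresentation R (P.complex.X n) := fun n => by
    have := hP n
    have := module_projective (P.projective n)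
    exact Module.finitePresentation_of_projective R (P.complex.X n)
  let a : (P.complex.X 0 →ₗ[R] I) →+ (P.complex.X 1 →ₗ[R] I) :=
    { toFun := fun f => f ∘ₗ (P.complex.d 1 0).hom
      map_zero' := rfl
      map_add' := fun _ _ => rfl }
  let b : (P.complex.X 1 →ₗ[R] I) →+ (P.complex.X 2 →ₗ[R] I) :=
    { toFun := fun f => f ∘ₗ (P.complex.d 2 1).hom
      map_zero' := rfl
      map_add' := fun _ _ => rfl }
  have hab : ∀ f, b (a f) = 0 := fun f => by
    ext x
    exact (congrArg f (resolution_d_d P x)).trans (map_zero f)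
  have h1 : Subsingleton (Abelian.Ext N (ModuleCat.of R I) 1) ↔ Function.Exact a b := by
    rw [ext_one_subsingleton_iff P]
    exact ⟨fun h f => ⟨h f, by rintro ⟨g, rfl⟩; exact hab g⟩, fun h f hf => (h f).1 hf⟩
  rw [h1, exact_iff_characters a b hab, torL_one_subsingleton_iff _ P]
  have hB := fun n => charTens_bijective (S := R) I (P.complex.X n)
  have hd1 : ∀ z, tmap R LinearMap.id (P.complex.d 1 0).hom z = 0 ↔
      ∀ f, charTens I (P.complex.X 1) z (a f) = 0 := fun z => by
    rw [← map_eq_zero_iff _ (hB 0).1, DFunLike.ext_iff]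
    exact forall_congr' fun f => by rw [charTens_naturality]; rfl
  constructor
  · intro h z
    rw [hd1]
    constructor
    · intro hz
      obtain ⟨ψ, hψ⟩ := h _ hz
      obtain ⟨w, rfl⟩ := (hB 2).2 ψ
      refine ⟨w, (hB 1).1 ?_⟩
      ext f
      rw [charTens_naturality, ← hψ f]; rfl
    · rintro ⟨w, rfl⟩ f
      rw [charTens_naturality]
      exact (congrArg _ (hab f)).trans (map_zero _)
  · intro h φ hφ
    obtain ⟨z, rfl⟩ := (hB 1).2 φ
    obtain ⟨w, rfl⟩ := (h z).1 ((hd1 z).2 hφ)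
    exact ⟨charTens I _ w, fun f => (charTens_naturality I _ w f).symm⟩

theorem weakInjective_iff (I : Type u) [AddCommGroup I] [Module R I] :
    WeakInjective R I ↔ WeakFlatRight R (charModule R I) :=
  forall_congr' fun _ => forall_congr' fun hN =>
    ext_subsingleton_iff_torL I hN.choose hN.choose_spec

theorem WeakInjective.of_linearEquiv {I J : Type u} [AddCommGroup I] [Module R I] [AddCommGroup J]
    [Module R J] (e : I ≃ₗ[R] J) (h : WeakInjective R I) : WeakInjective R J := by
  intro N hN
  obtain ⟨P, hP⟩ := id hN
  refine (ext_one_subsingleton_iff P _).2 fun f hf => ?_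
  obtain ⟨g, hg⟩ := (ext_one_subsingleton_iff P _).1 (h N hN) (e.symm.toLinearMap ∘ₗ f) (by
    rw [LinearMap.comp_assoc, hf, LinearMap.comp_zero])
  refine ⟨e.toLinearMap ∘ₗ g, ?_⟩
  ext x
  exact e.symm.injective ((e.symm_apply_apply _).trans (LinearMap.congr_fun hg x))

theorem WeakFlatRight.of_linearEquiv {F G : Type u} [AddCommGroup F] [Module Rᵐᵒᵖ F]
    [AddCommGroup G] [Module Rᵐᵒᵖ G] (e : F ≃ₗ[Rᵐᵒᵖ] G) (h : WeakFlatRight R F) :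
    WeakFlatRight R G := by
  rw [weakFlatRight_iff] at h ⊢
  refine h.of_linearEquiv (LinearEquiv.symm
    { toFun := fun φ => (leftCharEquiv R F).symm ((leftCharEquiv R G φ).comp e.toAddEquiv)
      invFun := fun φ => (leftCharEquiv R G).symm ((leftCharEquiv R F φ).comp e.symm.toAddEquiv)
      left_inv := fun φ => (leftCharEquiv R G).injective (by ext x; simp)
      right_inv := fun φ => (leftCharEquiv R F).injective (by ext x; simp)
      map_add' := fun _ _ => rfl
      map_smul' := fun r φ => (leftCharEquiv R F).injective <| by
        ext x; exact congrArg (leftCharEquiv R G φ) (map_smul e (op r) x).symm })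

end Duality

/-- Two groups in additive bijection with a third one are linearly isomorphic when the actions
correspond. -/
def linearEquivOfBijective {A : Type*} [Ring A] {T X Y : Type*} [AddCommGroup T] [AddCommGroup X]
    [Module A X] [AddCommGroup Y] [Module A Y] (a : T →+ X) (b : T →+ Y)
    (ha : Function.Bijective a) (hb : Function.Bijective b)
    (h : ∀ (r : A) (z : T), ∃ z', a z' = r • a z ∧ b z' = r • b z) : X ≃ₗ[A] Y where
  toAddEquiv := (AddEquiv.ofBijective a ha).symm.trans (AddEquiv.ofBijective b hb)
  map_smul' r x := by
    obtain ⟨z, rfl⟩ := ha.2 x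
    obtain ⟨z', h1, h2⟩ := h r z
    have hs : ∀ w, (AddEquiv.ofBijective a ha).symm (a w) = w :=
      (AddEquiv.ofBijective a ha).symm_apply_apply
    change b ((AddEquiv.ofBijective a ha).symm (r • a z)) =
      r • b ((AddEquiv.ofBijective a ha).symm (a z))
    rw [← h1, hs, hs, h2]

theorem linearEquivOfBijective_apply {A : Type*} [Ring A] {T X Y : Type*} [AddCommGroup T]
    [AddCommGroup X] [Module A X] [AddCommGroup Y] [Module A Y] (a : T →+ X) (b : T →+ Y)
    (ha : Function.Bijective a) (hb : Function.Bijective b)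
    (h : ∀ (r : A) (z : T), ∃ z', a z' = r • a z ∧ b z' = r • b z) (z : T) :
    linearEquivOfBijective a b ha hb h (a z) = b z :=
  congrArg b ((AddEquiv.ofBijective a ha).symm_apply_apply z)

/-! ### Module structures, adjunctions and units for the bimodule `C` -/

section Bimodule

variable (S R C : Type u) [Ring S] [Ring R] [AddCommGroup C] [Module S C] [Module Rᵐᵒᵖ C]
variable [SMulCommClass S Rᵐᵒᵖ C]

/-- The underlying group of `C ⊗_R F`. -/
def tensObjEquiv (F : Type u) [AddCommGroup F] [Module R F] : tensObj S R C F ≃+ Tens R C F :=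
  AddEquiv.refl _

theorem tensObj_smul (F : Type u) [AddCommGroup F] [Module R F] (s : S) (z : tensObj S R C F) :
    tensObjEquiv S R C F (s • z) = tmap R (leftMul S R C s) LinearMap.id (tensObjEquiv S R C F z) :=
  rfl

/-- The underlying group of `F ⊗_S C`. -/
def tensObjRightEquiv (F : Type u) [AddCommGroup F] [Module Sᵐᵒᵖ F] :
    tensObjRight S R C F ≃+ Tens S F C :=
  AddEquiv.refl _

theorem tensObjRight_smul (F : Type u) [AddCommGroup F] [Module Sᵐᵒᵖ F] (r : Rᵐᵒᵖ)
    (z : tensObjRight S R C F) :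
    tensObjRightEquiv S R C F (r • z) =
      tmap S LinearMap.id (rightMul S R C r.unop) (tensObjRightEquiv S R C F z) :=
  rfl

/-- The underlying group of `Hom_S(C, I)`. -/
def homObjEquiv (I : Type u) [AddCommGroup I] [Module S I] : homObj S R C I ≃+ (C →ₗ[S] I) :=
  AddEquiv.refl _

@[simp] theorem homObj_smul (I : Type u) [AddCommGroup I] [Module S I] (r : R)
    (f : homObj S R C I) (c : C) :
    homObjEquiv S R C I (r • f) c = homObjEquiv S R C I f (op r • c) := rfl

/-- The underlying group of `Hom_{Rᵒᵖ}(C, I)`. -/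
def homObjRightEquiv (I : Type u) [AddCommGroup I] [Module Rᵐᵒᵖ I] :
    homObjRight S R C I ≃+ (C →ₗ[Rᵐᵒᵖ] I) :=
  AddEquiv.refl _

@[simp] theorem homObjRight_smul (I : Type u) [AddCommGroup I] [Module Rᵐᵒᵖ I] (s : Sᵐᵒᵖ)
    (f : homObjRight S R C I) (c : C) :
    homObjRightEquiv S R C I (s • f) c = homObjRightEquiv S R C I f (s.unop • c) := rfl

/-- Functoriality of `Hom_{Rᵒᵖ}(C, -)` on isomorphisms. -/
def homObjRightCongr {I J : Type u} [AddCommGroup I] [Module Rᵐᵒᵖ I] [AddCommGroup J]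
    [Module Rᵐᵒᵖ J] (e : I ≃ₗ[Rᵐᵒᵖ] J) : homObjRight S R C I ≃ₗ[Sᵐᵒᵖ] homObjRight S R C J where
  toFun f := (homObjRightEquiv S R C J).symm (e.toLinearMap ∘ₗ homObjRightEquiv S R C I f)
  invFun f := (homObjRightEquiv S R C I).symm (e.symm.toLinearMap ∘ₗ homObjRightEquiv S R C J f)
  left_inv f := (homObjRightEquiv S R C I).injective (by ext c; simp)
  right_inv f := (homObjRightEquiv S R C J).injective (by ext c; simp)
  map_add' f g := (homObjRightEquiv S R C J).injective (by ext c; simp)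
  map_smul' s f := (homObjRightEquiv S R C J).injective (by ext c; rfl)

/-- The adjunction isomorphism `(C ⊗_R F)⁺ ≅ Hom_{Rᵒᵖ}(C, F⁺)`. -/
def charTensObj (F : Type u) [AddCommGroup F] [Module R F] :
    charModule S (tensObj S R C F) ≃ₗ[Sᵐᵒᵖ] homObjRight S R C (charModule R F) where
  toAddEquiv := (charEquiv S (tensObj S R C F)).trans
    (curryRight.trans (homObjRightEquiv S R C (charModule R F)).symm)
  map_smul' s Ψ := (homObjRightEquiv S R C (charModule R F)).injective <| by
    ext c; exact (charEquiv R F).injective (by ext x; rfl)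

/-- The map `I⁺ ⊗_S C → Hom_S(C, I)⁺` as a map of right `R`-modules. -/
def charTensHomObj (I : Type u) [AddCommGroup I] [Module S I] :
    tensObjRight S R C (charModule S I) →ₗ[Rᵐᵒᵖ] charModule R (homObj S R C I) where
  toFun z := (charEquiv R (homObj S R C I)).symm (charTens I C (tensObjRightEquiv S R C _ z))
  map_add' x y := map_add (charTens I C) x y
  map_smul' r z := (charEquiv R (homObj S R C I)).injective <| by
    ext f
    rw [tensObjRight_smul]
    exact charTens_naturality I (rightMul S R C r.unop) _ _

theorem charTensHomObj_bijective [Module.FinitePresentation S C] (I : Type u) [AddCommGroup I]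
    [Module S I] : Function.Bijective (charTensHomObj S R C I) :=
  charTens_bijective I C

variable {S R C}

theorem Semidualizing.finitePresentation_left (hC : Semidualizing S R C) :
    Module.FinitePresentation S C :=
  hC.superFP_left.finitePresentation

theorem Semidualizing.finitePresentation_right (hC : Semidualizing S R C) :
    Module.FinitePresentation Rᵐᵒᵖ C :=
  hC.superFP_right.finitePresentation

/-- Evaluation `Hom_{Rᵒᵖ}(C, I) ⊗_S C → I` is bijective for weak injective `I`. -/
theorem Semidualizing.evaluation_bijective (hC : Semidualizing S R C) {I : Type u}
    [AddCommGroup I] [Module Rᵐᵒᵖ I] (hI : WeakInjective Rᵐᵒᵖ I) {X : Type u} [AddCommGroup X]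
    [Module Sᵐᵒᵖ X] (θ : X ≃ₗ[Sᵐᵒᵖ] homObjRight S R C I) (ev : Tens S X C →+ I)
    (hev : ∀ x c, ev (tmul S x c) = homObjRightEquiv S R C I (θ x) c) : Function.Bijective ev := by
  have := hC.finitePresentation_left
  obtain ⟨n, m, c, r, hp⟩ := exists_isPresentedBy (A := S) C
  have : SMulCommClass Rᵐᵒᵖ S C := SMulCommClass.symm S Rᵐᵒᵖ C
  -- The roles are `A = Rᵐᵒᵖ` and `B = S`, with `Rᵐᵒᵖ` acting as `End_S(C)` by homothety. `hs` gives
  -- surjectivity of `ev`, `hi` injectivity.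
  obtain ⟨hs, hi⟩ := hI.presentation_exact (B := S) hC.superFP_right hp
    (fun a ha => by
      have h0 : rightMul S R C a.unop = rightMul S R C 0 := by
        ext x
        change a • x = (0 : Rᵐᵒᵖ) • x
        rw [ha, zero_smul]
      exact unop_injective (hC.homothety_right.1 h0))
    (fun φ => by
      obtain ⟨a, rfl⟩ := hC.homothety_right.2 φ
      exact ⟨op a, fun x => rfl⟩)
  constructor
  · refine (injective_iff_map_eq_zero _).2 fun z hz => ?_
    obtain ⟨x, rfl⟩ := exists_tens_eq_sum_right (R := S) hp.exists_eq_sum z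
    obtain ⟨g, hg⟩ := hi (fun i => homObjRightEquiv S R C I (θ (x i))) (by
      rw [map_sum] at hz
      simpa only [hev] using hz)
    have key : ∀ i, x i = ∑ j, op (r j i) • θ.symm ((homObjRightEquiv S R C I).symm (g j)) :=
      fun i => θ.injective ((homObjRightEquiv S R C I).injective (by
        ext y
        rw [hg]
        simp_rw [map_sum, map_smul, LinearEquiv.apply_symm_apply, LinearMap.sum_apply,
          homObjRight_smul, AddEquiv.apply_symm_apply, unop_op]))
    simp_rw [key, sum_tmul, smul_tmul]
    rw [Finset.sum_comm]
    simp_rw [← tmul_sum, hp.relation, tmul_zero, Finset.sum_const_zero]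
  · intro x
    obtain ⟨f, rfl⟩ := hs x
    refine ⟨∑ i, tmul S (θ.symm ((homObjRightEquiv S R C I).symm (f i))) (c i), ?_⟩
    simp [hev]

variable (S R C) in
/-- The unit `F → Hom_{Rᵒᵖ}(C, F ⊗_S C)`. -/
def unitHom (F : Type u) [AddCommGroup F] [Module Sᵐᵒᵖ F] :
    F →ₗ[Sᵐᵒᵖ] homObjRight S R C (tensObjRight S R C F) where
  toFun x := (homObjRightEquiv S R C (tensObjRight S R C F)).symm
    { toFun := fun c => (tensObjRightEquiv S R C F).symm (tmul S x c)
      map_add' := fun c c' => tmul_add S x c c'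
      map_smul' := fun _ _ => rfl }
  map_add' x y := (homObjRightEquiv S R C (tensObjRight S R C F)).injective <| by
    ext c; exact add_tmul S x y c
  map_smul' s x := (homObjRightEquiv S R C (tensObjRight S R C F)).injective <| by
    ext c; exact smul_tmul S s.unop x c

/-- `F⁺` is weak injective and `Hom_S(C, F⁺) = (F ⊗ C)⁺`, so `presentation_exact` with `A = S`, `B =
Rᵐᵒᵖ` is the character dual of the exact sequence `0 → F → (F ⊗ C)ⁿ → (F ⊗ C)ᵐ`, whose kernel term
is also `Hom(C, F ⊗ C)`. -/
theorem Semidualizing.unitHom_bijective (hC : Semidualizing S R C) {F : Type u} [AddCommGroup F]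
    [Module Sᵐᵒᵖ F] (hF : WeakFlatRight S F) : Function.Bijective (unitHom S R C F) := by
  have := hC.finitePresentation_right
  obtain ⟨n, m, c, r, hp⟩ := exists_isPresentedBy (A := Rᵐᵒᵖ) C
  obtain ⟨hs, hi⟩ := ((weakFlatRight_iff F).1 hF).presentation_exact (B := Rᵐᵒᵖ) hC.superFP_left hp
    (fun a ha => by
      have h0 : leftMul S R C a = leftMul S R C 0 := by
        ext x
        change a • x = (0 : S) • x
        rw [ha, zero_smul]
      exact hC.homothety_left.1 h0)
    (fun φ => by
      obtain ⟨a, rfl⟩ := hC.homothety_left.2 φ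
      exact ⟨a, fun x => rfl⟩)
  constructor
  · refine (injective_iff_map_eq_zero _).2 fun x hx => ?_
    by_contra hne
    obtain ⟨φ, hφ⟩ := exists_character_ne_zero hne
    obtain ⟨f, hf⟩ := hs ((leftCharEquiv S F).symm φ)
    have hx' : ∀ i, tmul S x (c i) = 0 := fun i =>
      LinearMap.congr_fun (congrArg (homObjRightEquiv S R C _) hx) (c i)
    apply hφ
    have h1 : φ x = leftCharEquiv S F (∑ i, f i (c i)) x := by rw [hf]; rfl
    rw [h1, map_sum, AddMonoidHom.finsetSum_apply]
    refine Finset.sum_eq_zero fun i _ => ?_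
    rw [← curryLeft_symm_tmul, hx', map_zero]
  · intro h
    let ev : F →+ (Fin n → Tens S F C) :=
      { toFun := fun x i => tmul S x (c i)
        map_zero' := funext fun i => zero_tmul S _
        map_add' := fun x y => funext fun i => add_tmul S x y _ }
    let y : Fin n → Tens S F C := fun i =>
      tensObjRightEquiv S R C F (homObjRightEquiv S R C _ h (c i))
    by_cases hy : y ∈ ev.range
    · obtain ⟨x, hx⟩ := hy
      exact ⟨x, (homObjRightEquiv S R C _).injective (hp.ext fun i => congrFun hx i)⟩
    exfalso
    -- The components of a separating character satisfy `∑ fᵢ(cᵢ) = 0` in `F⁺`, so they come from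
    -- the relations; but `h` respects the relations, which forces `Ψ y = 0`.
    obtain ⟨Ψ, hΨ, hne⟩ := exists_character_of_notMem_range ev hy
    let ψ : Fin n → (Tens S F C →+ QZ) := fun i => Ψ.comp (AddMonoidHom.single (fun _ => Tens S F C) i)
    obtain ⟨g, hg⟩ := hi (fun i => curryLeft (ψ i)) ((leftCharEquiv S F).injective (by
      ext x
      rw [map_sum, AddMonoidHom.finsetSum_apply]
      simp_rw [curryLeft_apply]
      exact (character_pi_apply Ψ (ev x)).symm.trans (hΨ x)))
    have key : ∀ i (t : tensObjRight S R C F), ψ i (tensObjRightEquiv S R C F t) =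
        ∑ j, curryLeft.symm (g j) (tensObjRightEquiv S R C F (r j i • t)) := fun i t => by
      simp_rw [tensObjRight_smul]
      generalize tensObjRightEquiv S R C F t = t
      induction t using tens_induction with
      | zero => simp
      | tmul x d =>
        rw [← curryLeft_apply (ψ i), hg, map_sum, AddMonoidHom.finsetSum_apply]
        rfl
      | add a b ha hb => simp_rw [map_add, ha, hb, Finset.sum_add_distrib]
    apply hne
    rw [character_pi_apply]
    refine (Finset.sum_congr rfl fun i _ => key i _).trans ?_
    rw [Finset.sum_comm]
    refine Finset.sum_eq_zero fun j _ => ?_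
    simp_rw [← map_sum, ← map_smul, ← map_sum, hp.relation, map_zero]

variable (S R C) in
/-- The evaluation map `C ⊗_R Hom_S(C, V) → V`. -/
def counitHom (V : Type u) [AddCommGroup V] [Module S V] :
    tensObj S R C (homObj S R C V) →ₗ[S] V where
  toFun z := tlift (LinearMap.toAddMonoidHom'.comp
    (homObjEquiv S R C V).toAddMonoidHom).flip (fun r c f => rfl) (tensObjEquiv S R C _ z)
  map_add' x y := by rw [map_add, map_add]
  map_smul' s z := by
    rw [tensObj_smul]
    generalize tensObjEquiv S R C (homObj S R C V) z = z
    induction z using tens_induction with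
    | zero => simp
    | tmul c f => exact map_smul (homObjEquiv S R C V f) s c
    | add x y hx hy => simp only [map_add, hx, hy, smul_add]

variable (S R C) in
/-- The map `U → Hom_S(C, C ⊗_R U)`. -/
def unitHomLeft (U : Type u) [AddCommGroup U] [Module R U] :
    U →ₗ[R] homObj S R C (tensObj S R C U) where
  toFun u := (homObjEquiv S R C (tensObj S R C U)).symm
    { toFun := fun c => (tensObjEquiv S R C U).symm (tmul R c u)
      map_add' := fun c c' => add_tmul R c c' u
      map_smul' := fun _ _ => rfl }
  map_add' x y := (homObjEquiv S R C (tensObj S R C U)).injective <| by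
    ext c; exact tmul_add R c x y
  map_smul' r x := (homObjEquiv S R C (tensObj S R C U)).injective <| by
    ext c; exact (smul_tmul R r c x).symm

/-! ### The two equivalences -/

theorem CWeakFlat.charModule {V : Type u} [AddCommGroup V] [Module S V]
    (h : CWeakFlat S R C (ModuleCat.of S V)) : CWeakInjectiveRight S R C (charModule S V) := by
  obtain ⟨F, hF, ⟨e⟩⟩ := h
  exact ⟨CWeak.charModule R F, (weakFlat_iff F).1 hF,
    ⟨((charCongr S e.toLinearEquiv).symm.trans (charTensObj S R C F)).toModuleIso⟩⟩

theorem Semidualizing.cWeakFlat_of_charModule (hC : Semidualizing S R C) {V : Type u}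
    [AddCommGroup V] [Module S V] (h : CWeakInjectiveRight S R C (charModule S V)) :
    CWeakFlat S R C (ModuleCat.of S V) := by
  obtain ⟨I, hI, ⟨e⟩⟩ := h
  have := hC.finitePresentation_left
  let θ : charModule S V ≃ₗ[Sᵐᵒᵖ] homObjRight S R C I := e.toLinearEquiv
  let ev : Tens S (charModule S V) C →+ I :=
    tlift (LinearMap.toAddMonoidHom'.comp
      ((homObjRightEquiv S R C I).toAddMonoidHom.comp θ.toLinearMap.toAddMonoidHom))
      fun s φ c => LinearMap.congr_fun (congrArg (homObjRightEquiv S R C I) (map_smul θ (op s) φ)) c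
  have hev : ∀ φ c, ev (tmul S φ c) = homObjRightEquiv S R C I (θ φ) c := fun φ c => rfl
  have hbij := hC.evaluation_bijective hI θ ev hev
  let a : Tens S (charModule S V) C →+ charModule R (homObj S R C V) :=
    (charTensHomObj S R C V).toAddMonoidHom.comp
      (tensObjRightEquiv S R C (charModule S V)).symm.toAddMonoidHom
  have ha : Function.Bijective a := charTensHomObj_bijective S R C V
  -- `V⁺ ⊗ C` maps bijectively to `Hom(C, V)⁺` because `C` is finitely presented, and to `I` by
  -- evaluation.
  let α : charModule R (homObj S R C V) ≃ₗ[Rᵐᵒᵖ] I :=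
    linearEquivOfBijective a ev ha hbij fun r z =>
      ⟨tmap S LinearMap.id (rightMul S R C r.unop) z,
        map_smul (charTensHomObj S R C V) r ((tensObjRightEquiv S R C _).symm z), by
          induction z using tens_induction with
          | zero => simp
          | tmul φ c => exact map_smul (homObjRightEquiv S R C I (θ φ)) r c
          | add x y hx hy => simp only [map_add, hx, hy, smul_add]⟩
  have hα : ∀ φ c, α (a (tmul S φ c)) = homObjRightEquiv S R C I (θ φ) c := fun φ c =>
    linearEquivOfBijective_apply a ev ha hbij _ _
  have hE : Function.Bijective (counitHom S R C V) := by
    refine bijective_of_dual_bijective (counitHom S R C V).toAddMonoidHom ?_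
    -- `Θ` is `(C ⊗ Hom(C, V))⁺ ≅ Hom(C, Hom(C, V)⁺) ≅ Hom(C, I)`; composed with the dual of the
    -- evaluation it is `θ`.
    let Θ := (charEquiv S (tensObj S R C (homObj S R C V))).symm.toEquiv.trans
      ((charTensObj S R C (homObj S R C V)).trans (homObjRightCongr S R C α)).toEquiv
    refine (Function.Bijective.of_comp_iff' Θ.bijective _).1 ?_
    convert θ.bijective.comp (charEquiv S V).symm.bijective using 1
    refine funext fun φ => (homObjRightEquiv S R C I).injective ?_
    ext c
    exact hα ((charEquiv S V).symm φ) c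
  exact ⟨homObj S R C V, (weakFlat_iff _).2 (hI.of_linearEquiv α.symm),
    ⟨(LinearEquiv.ofBijective (counitHom S R C V) hE).symm.toModuleIso⟩⟩

theorem Semidualizing.charModule_cWeakFlatRight (hC : Semidualizing S R C) {U : Type u}
    [AddCommGroup U] [Module R U] (h : CWeakInjective S R C (ModuleCat.of R U)) :
    CWeakFlatRight S R C (charModule R U) := by
  obtain ⟨I, hI, ⟨e⟩⟩ := h
  have := hC.finitePresentation_left
  exact ⟨charModule S I, (weakInjective_iff I).1 hI,
    ⟨((charCongr R e.toLinearEquiv).symm.trans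
      (LinearEquiv.ofBijective _ (charTensHomObj_bijective S R C I)).symm).toModuleIso⟩⟩

theorem Semidualizing.cWeakInjective_of_charModule (hC : Semidualizing S R C) {U : Type u}
    [AddCommGroup U] [Module R U] (h : CWeakFlatRight S R C (charModule R U)) :
    CWeakInjective S R C (ModuleCat.of R U) := by
  obtain ⟨F, hF, ⟨e⟩⟩ := h
  have := hC.finitePresentation_left
  let θ : charModule R U ≃ₗ[Rᵐᵒᵖ] tensObjRight S R C F := e.toLinearEquiv
  let I := tensObj S R C U
  -- `F ≅ Hom(C, F ⊗ C) ≅ Hom(C, U⁺) ≅ (C ⊗ U)⁺`.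
  let β : F ≃ₗ[Sᵐᵒᵖ] charModule S I :=
    ((LinearEquiv.ofBijective _ (hC.unitHom_bijective hF)).trans
      (homObjRightCongr S R C θ.symm)).trans (charTensObj S R C U).symm
  have hβ : ∀ x c u, charEquiv S I (β x) ((tensObjEquiv S R C U).symm (tmul R c u)) =
      charEquiv R U (θ.symm ((tensObjRightEquiv S R C F).symm (tmul S x c))) u :=
    fun x c u => rfl
  have hI : WeakInjective S I := (weakInjective_iff _).2 (hF.of_linearEquiv β)
  have hν : Function.Bijective (unitHomLeft S R C U) := by
    refine bijective_of_dual_bijective (unitHomLeft S R C U).toAddMonoidHom ?_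
    let b : Tens S F C → Tens S (charModule S I) C := tmap S β.toLinearMap LinearMap.id
    have hb : Function.Bijective b := by
      refine Function.bijective_iff_has_inverse.2
        ⟨tmap S β.symm.toLinearMap LinearMap.id, fun z => ?_, fun z => ?_⟩
      · induction z using tens_induction with
        | zero => simp [b]
        | tmul x c => simp [b]
        | add x y hx hy => simp only [b, map_add] at hx hy ⊢; rw [hx, hy]
      · induction z using tens_induction with
        | zero => simp [b]
        | tmul x c => simp [b]
        | add x y hx hy => simp only [b, map_add] at hx hy ⊢; rw [hx, hy]
    -- Precomposed with `F ⊗ C ≅ I⁺ ⊗ C ≅ Hom(C, I)⁺`, the dual of the unit becomes `θ⁻¹ : F ⊗ C →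
    -- U⁺`; on elementary tensors this is `hβ`.
    refine (Function.Bijective.of_comp_iff _ ((charTens_bijective I C).comp hb)).1 ?_
    convert (charEquiv R U).bijective.comp
      (θ.symm.bijective.comp (tensObjRightEquiv S R C F).symm.bijective) using 1
    let l : Tens S F C →+ (U →+ QZ) :=
      (AddMonoidHom.compHom' (unitHomLeft S R C U).toAddMonoidHom).comp
        ((charTens I C).comp (tmap S β.toLinearMap LinearMap.id))
    let l' : Tens S F C →+ (U →+ QZ) := (charEquiv R U).toAddMonoidHom.comp
      (θ.symm.toLinearMap.toAddMonoidHom.comp (tensObjRightEquiv S R C F).symm.toAddMonoidHom)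
    have hl : l = l' := tens_hom_ext S fun x c => by ext u; exact hβ x c u
    exact funext fun z => DFunLike.congr_fun hl z
  exact ⟨I, hI, ⟨(LinearEquiv.ofBijective (unitHomLeft S R C U) hν).toModuleIso⟩⟩

end Bimodule

end CWeak

end

theorem proposition2p6 (S R C : Type u) [Ring S] [Ring R] [AddCommGroup C] [Module S C]
    [Module Rᵐᵒᵖ C] [SMulCommClass S Rᵐᵒᵖ C] (hC : CWeak.FaithfullySemidualizing S R C)
    (V : Type u) [AddCommGroup V] [Module S V] (U : Type u) [AddCommGroup U] [Module R U] :
    (CWeak.CWeakFlat S R C (ModuleCat.of S V) ↔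
      CWeak.CWeakInjectiveRight S R C (CWeak.charModule S V)) ∧
    (CWeak.CWeakInjective S R C (ModuleCat.of R U) ↔
      CWeak.CWeakFlatRight S R C (CWeak.charModule R U)) :=
  ⟨⟨CWeak.CWeakFlat.charModule, hC.toSemidualizing.cWeakFlat_of_charModule⟩,
    ⟨hC.toSemidualizing.charModule_cWeakFlatRight, hC.toSemidualizing.cWeakInjective_of_charModule⟩⟩
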